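/- Let $\theta>0$, let $W$ be a standard Brownian motion, and let $(Y_t)_{t\ge 0}$ be a stationary Ornstein–Uhlenbeck process, i.e. a strictly stationary process with almost surely continuous paths, with $Y_0$ independent of $W$, satisfying $$dY_t=-\theta Y_t\,dt+\sqrt{2\theta}\,dW_t,\qquad\text{that is,}\qquad Y_t=Y_0-\theta\int_0^t Y_s\,ds+\sqrt{2\theta}\,W_t\quad (t\ge 0)\ \text{almost surely.}$$ Then for every $T>0$ the integral $\int_0^T \ln|Y_t|\,dt$ exists almost surely and is a square-integrable random variable, and there is a constant $\eta_\theta>0$ such that $$\eta_\theta^2=\lim_{T\to\infty}\operatorname{Var}\left(\frac1{\sqrt T}\int_0^T\ln|Y_t|\,dt\right)=\frac1\theta\sum_{k=1}^\infty\frac{2^{2k-2}\,(k-1)!^2}{(2k)!\,k}=\frac1\theta\sum_{n=0}^\infty\frac{2^{2n-1}}{\binom{2n}{n}(n+1)^2(2n+1)}=\frac1\theta\left(\frac{\pi^2\ln 2}{4}-\frac{7\zeta(3)}{8}\right),$$ where $\zeta$ is the Riemann zeta function and both series converge. -/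

import Mathlib

open MeasureTheory ProbabilityTheory Filter Topology
open scoped NNReal

/-- A real-valued process indexed by `[0, ∞)` is (strictly) stationary if its finite-dimensional
laws are invariant under every time shift `h ≥ 0`. -/
structure IsStationaryProcess {Ω : Type*} [MeasurableSpace Ω]
    (Y : ℝ≥0 → Ω → ℝ) (P : Measure Ω) : Prop where
  identDistrib_shift : ∀ (h : ℝ≥0) (I : Finset ℝ≥0),
    IdentDistrib (fun ω (t : I) => Y ((t : ℝ≥0) + h) ω) (fun ω (t : I) => Y (t : ℝ≥0) ω) P P

/-- `Y` is a solution on `[0, ∞)` of the Ornstein–Uhlenbeck equation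
`dY = -θ Y dt + √(2θ) dW` driven by the Brownian motion `W`: the initial value is independent
of `W`, the paths are almost surely continuous, and almost surely, for all `t ≥ 0`,
`Y_t = Y_0 - θ ∫₀ᵗ Y_s ds + √(2θ) W_t`.
(The stochastic integral of the constant `√(2θ)` over `[0, t]` is `√(2θ) (W_t - W_0)`, and
`W_0 = 0` almost surely.) -/
structure IsOrnsteinUhlenbeck {Ω : Type*} [MeasurableSpace Ω] (θ : ℝ)
    (W Y : ℝ≥0 → Ω → ℝ) (P : Measure Ω) : Prop where
  isBrownian : IsBrownianReal W P
  aemeasurable : ∀ t, AEMeasurable (Y t) P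
  indep_initial : IndepFun (Y 0) (fun ω t => W t ω) P
  continuous_paths : ∀ᵐ ω ∂P, Continuous (fun t => Y t ω)
  integral_equation : ∀ᵐ ω ∂P, ∀ t : ℝ≥0,
    Y t ω = Y 0 ω - θ * (∫ s in (0 : ℝ)..t, Y s.toNNReal ω) + √(2 * θ) * W t ω

/-- The path integral `∫₀ᵀ ln|Y_t| dt`, as a random variable. -/
noncomputable def logIntegral {Ω : Type*} (Y : ℝ≥0 → Ω → ℝ) (T : ℝ) (ω : Ω) : ℝ :=
  ∫ t in (0 : ℝ)..T, Real.log |Y t.toNNReal ω|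

/-- Convergence of the explicit Euler scheme along a continuous path solving the integral form of
a linear equation with additive driving path `w`. -/
lemma tendsto_euler_scheme {θ c : ℝ} (hθ : 0 < θ) {y w : ℝ≥0 → ℝ} (hy : Continuous y)
    (h : ∀ t : ℝ≥0, y t = y 0 - θ * (∫ s in (0 : ℝ)..t, y s.toNNReal) + c * w t) (t : ℝ≥0) :
    Tendsto (fun n : ℕ => (1 - θ * t / n) ^ n * y 0 + c * ∑ i ∈ Finset.range n,
      (1 - θ * t / n) ^ (n - 1 - i) * (w ((i + 1 : ℕ) * t / n) - w ((i : ℕ) * t / n)))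
      atTop (𝓝 (y t)) := by
  set Y : ℝ → ℝ := fun s => y s.toNNReal with hYdef
  have hYc : Continuous Y := hy.comp continuous_real_toNNReal
  have hint : ∀ a b : ℝ, IntervalIntegrable Y volume a b := fun a b => hYc.intervalIntegrable a b
  rw [Metric.tendsto_atTop]
  intro ε hε
  have hε' : 0 < ε / (θ * t + 1) := by positivity
  set e := ε / (θ * t + 1) with he
  have huc : UniformContinuousOn Y (Set.Icc 0 (t : ℝ)) :=
    isCompact_Icc.uniformContinuousOn_of_continuous hYc.continuousOn
  obtain ⟨δ, hδ, hδe⟩ := Metric.uniformContinuousOn_iff.1 huc e hε'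
  obtain ⟨N, hN⟩ := exists_nat_gt (max (t / δ) (θ * t))
  refine ⟨N + 1, fun n hn => ?_⟩
  have hnN : (N : ℝ) + 1 ≤ n := by exact_mod_cast hn
  have hn0 : (0 : ℝ) < n := by have : (0 : ℝ) ≤ N := by positivity
                               linarith
  have hn1 : (t : ℝ) / δ < n := lt_of_le_of_lt (le_max_left _ _) (by linarith)
  have hn2 : θ * t < n := lt_of_le_of_lt (le_max_right _ _) (by linarith)
  set d : ℝ := t / n with hd
  have hd0 : 0 ≤ d := by positivity
  have hdδ : d < δ := by
    rw [hd, div_lt_iff₀ hn0]; rw [div_lt_iff₀ hδ] at hn1; linarith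
  set a : ℝ := 1 - θ * t / n with ha
  have had : a = 1 - θ * d := by rw [ha, hd]; ring
  have ha0 : 0 ≤ a := by
    have : θ * t / n ≤ 1 := by rw [div_le_one hn0]; exact hn2.le
    rw [ha]; linarith
  have ha1 : a ≤ 1 := by
    have : 0 ≤ θ * t / n := by positivity
    rw [ha]; linarith
  set τ : ℕ → ℝ≥0 := fun i => (i : ℕ) * t / n with hτ
  have hτc : ∀ i, (τ i : ℝ) = i * d := by intro i; simp [hτ, hd]; ring
  have hY : ∀ s : ℝ≥0, Y s = y s := by intro s; simp [hYdef]
  have hloc : ∀ k < n, |y (τ (k + 1)) - a * y (τ k) - c * (w (τ (k + 1)) - w (τ k))|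
      ≤ θ * d * e := by
    intro k hk
    have hle : (τ k : ℝ) ≤ τ (k + 1) := by rw [hτc, hτc]; push_cast; nlinarith
    have hsub : (τ (k + 1) : ℝ) - τ k = d := by rw [hτc, hτc]; push_cast; ring
    have hlast : (τ (k + 1) : ℝ) ≤ t := by
      rw [hτc]
      have : ((k + 1 : ℕ) : ℝ) ≤ n := by exact_mod_cast hk
      calc ((k + 1 : ℕ) : ℝ) * d ≤ n * d := by gcongr
        _ = t := by rw [hd]; field_simp
    have e1 : y (τ (k + 1)) - a * y (τ k) - c * (w (τ (k + 1)) - w (τ k))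
        = θ * ∫ s in (τ k : ℝ)..τ (k + 1), (Y (τ k) - Y s) := by
      rw [intervalIntegral.integral_sub (by simp) (hint _ _), intervalIntegral.integral_const,
        hsub, ← intervalIntegral.integral_interval_sub_left (hint 0 _) (hint 0 _)]
      rw [h (τ (k + 1)), hY, had, smul_eq_mul]
      have := h (τ k)
      linear_combination -this
    rw [e1, abs_mul, abs_of_pos hθ, mul_assoc]
    gcongr
    have := intervalIntegral.norm_integral_le_of_norm_le_const (a := (τ k : ℝ)) (b := τ (k + 1))
      (f := fun s => Y (τ k) - Y s) (C := e) ?_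
    · rw [hsub, abs_of_nonneg hd0, Real.norm_eq_abs] at this
      linarith
    · intro s hs
      rw [Set.uIoc_of_le hle] at hs
      have h1 : dist (τ k : ℝ) s < δ := by
        rw [dist_comm, Real.dist_eq, abs_of_nonneg (by linarith [hs.1])]
        linarith [hs.2]
      have := hδe (τ k) ⟨by positivity, by linarith⟩ s
        ⟨by linarith [hs.1, (τ k).2], by linarith [hs.2]⟩ h1
      rw [Real.dist_eq] at this
      exact this.le
  have key : ∀ k ≤ n, |y (τ k) - (a ^ k * y 0 + c * ∑ i ∈ Finset.range k,
      a ^ (k - 1 - i) * (w (τ (i + 1)) - w (τ i)))| ≤ k * (θ * d * e) := by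
    intro k
    induction k with
    | zero => intro _; simp [hτ]
    | succ k ih =>
      intro hk
      have h1 := ih (by omega)
      have h2 := hloc k (by omega)
      have e2 : ∑ i ∈ Finset.range (k + 1), a ^ (k + 1 - 1 - i) * (w (τ (i + 1)) - w (τ i))
          = a * (∑ i ∈ Finset.range k, a ^ (k - 1 - i) * (w (τ (i + 1)) - w (τ i)))
            + (w (τ (k + 1)) - w (τ k)) := by
        rw [Finset.sum_range_succ, Finset.mul_sum]
        congr 1
        · refine Finset.sum_congr rfl fun i hi => ?_
          have : k + 1 - 1 - i = (k - 1 - i) + 1 := by have := Finset.mem_range.1 hi; omega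
          rw [this, pow_succ]; ring
        · simp
      rw [e2]
      set S := ∑ i ∈ Finset.range k, a ^ (k - 1 - i) * (w (τ (i + 1)) - w (τ i))
      have e3 : y (τ (k + 1)) - (a ^ (k + 1) * y 0 + c * (a * S + (w (τ (k + 1)) - w (τ k))))
          = (y (τ (k + 1)) - a * y (τ k) - c * (w (τ (k + 1)) - w (τ k)))
            + a * (y (τ k) - (a ^ k * y 0 + c * S)) := by rw [pow_succ]; ring
      rw [e3]
      refine (abs_add_le _ _).trans ?_
      rw [abs_mul, abs_of_nonneg ha0]
      have : a * |y (τ k) - (a ^ k * y 0 + c * S)| ≤ |y (τ k) - (a ^ k * y 0 + c * S)| :=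
        mul_le_of_le_one_left (abs_nonneg _) ha1
      push_cast
      linarith
  have hfin := key n le_rfl
  have hτn : τ n = t := by
    have : (n : ℝ≥0) ≠ 0 := by exact_mod_cast hn0.ne'
    simp [hτ]; field_simp
  rw [hτn] at hfin
  rw [dist_comm, Real.dist_eq]
  refine lt_of_le_of_lt hfin ?_
  have : (n : ℝ) * (θ * d * e) = θ * t * e := by rw [hd]; field_simp
  rw [this, he]
  rw [mul_div_assoc', div_lt_iff₀ (by positivity)]
  nlinarith [(t.2 : (0 : ℝ) ≤ t)]

lemma tendsto_charFun_of_ae_tendsto {Ω : Type*} [MeasurableSpace Ω] {P : Measure Ω}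
    [IsProbabilityMeasure P] {X : ℕ → Ω → ℝ} {Z : Ω → ℝ} (hX : ∀ n, AEMeasurable (X n) P)
    (hZ : AEMeasurable Z P) (h : ∀ᵐ ω ∂P, Tendsto (fun n => X n ω) atTop (𝓝 (Z ω))) (u : ℝ) :
    Tendsto (fun n => charFun (P.map (X n)) u) atTop (𝓝 (charFun (P.map Z) u)) := by
  have hm : ∀ {V : Ω → ℝ}, AEMeasurable V P →
      charFun (P.map V) u = ∫ ω, Complex.exp (u * V ω * Complex.I) ∂P := by
    intro V hV
    rw [charFun_apply_real, integral_map hV]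
    exact Continuous.aestronglyMeasurable (by fun_prop)
  rw [hm hZ]
  simp_rw [hm (hX _)]
  refine tendsto_integral_of_dominated_convergence (fun _ => 1) (fun n => ?_) (by simp)
    (fun n => ?_) ?_
  · exact (Continuous.measurable (f := fun x : ℝ => Complex.exp (u * x * Complex.I))
      (by fun_prop)).comp_aemeasurable (hX n) |>.aestronglyMeasurable
  · refine ae_of_all _ fun ω => ?_
    rw [← Complex.ofReal_mul, Complex.norm_exp_ofReal_mul_I]
  · filter_upwards [h] with ω hω
    exact ((Continuous.tendsto (f := fun x : ℝ => Complex.exp (u * x * Complex.I))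
      (by fun_prop) _).comp hω)

lemma map_sum_mul_gaussianReal {Ω : Type*} [MeasurableSpace Ω] {P : Measure Ω}
    [IsProbabilityMeasure P] {X : ℕ → Ω → ℝ} (hind : iIndepFun X P) {v : ℕ → ℝ≥0}
    (hX : ∀ i, HasLaw (X i) (gaussianReal 0 (v i)) P) (b : ℕ → ℝ) (s : Finset ℕ) :
    HasLaw (fun ω => ∑ i ∈ s, b i * X i ω)
      (gaussianReal 0 (∑ i ∈ s, NNReal.mk (b i ^ 2) (sq_nonneg _) * v i)) P := by
  have hind' : iIndepFun (fun i ω => b i * X i ω) P :=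
    hind.comp (fun i x => b i * x) (fun i => measurable_const_mul _)
  have hl : ∀ i, HasLaw (fun ω => b i * X i ω)
      (gaussianReal 0 (NNReal.mk (b i ^ 2) (sq_nonneg _) * v i)) P := by
    intro i
    simpa using gaussianReal_const_mul (hX i) (b i)
  induction s using Finset.induction_on with
  | empty =>
    refine ⟨by simp, ?_⟩
    simp
  | insert i s hi ih =>
    refine ⟨?_, ?_⟩
    · exact Finset.aemeasurable_fun_sum _ fun j _ => (hl j).aemeasurable
    · have h1 := (hind'.indepFun_finsetSum_of_notMem₀ (fun j => (hl j).aemeasurable) hi).symm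
      have h2 := gaussianReal_add_gaussianReal_of_indepFun h1 (hl i).map_eq
        (Y := ∑ j ∈ s, fun ω => b j * X j ω) (m₂ := 0)
        (v₂ := ∑ i ∈ s, NNReal.mk (b i ^ 2) (sq_nonneg _) * v i) ?_
      · rw [Finset.sum_insert hi]
        rw [show (0 : ℝ) + 0 = 0 by simp] at h2
        rw [← h2]
        congr 1
        ext ω
        simp [Finset.sum_insert hi]
      · rw [← ih.map_eq]
        congr 1
        ext ω
        simp

lemma tendsto_one_sub_div_pow_exp (x : ℝ) :
    Tendsto (fun n : ℕ => (1 - x / n) ^ n) atTop (𝓝 (Real.exp (-x))) := by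
  have := Real.tendsto_one_add_div_pow_exp (-x)
  simpa [neg_div, sub_eq_add_neg] using this

lemma tendsto_geom_sum_euler (x : ℝ) :
    Tendsto (fun n : ℕ => ∑ i ∈ Finset.range n, 2 * ((1 - x / n) ^ (n - 1 - i)) ^ 2 * (x / n))
      atTop (𝓝 (1 - Real.exp (-(2 * x)))) := by
  have h1 : Tendsto (fun n : ℕ => (1 - ((1 - x / n) ^ n) ^ 2) / (1 - x / n / 2)) atTop
      (𝓝 ((1 - (Real.exp (-x)) ^ 2) / (1 - 0 / 2))) := by
    refine Tendsto.div ?_ ?_ (by norm_num)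
    · exact tendsto_const_nhds.sub ((tendsto_one_sub_div_pow_exp x).pow 2)
    · exact tendsto_const_nhds.sub ((tendsto_const_div_atTop_nhds_zero_nat x).div_const 2)
  have e : (1 - (Real.exp (-x)) ^ 2) / (1 - 0 / 2) = 1 - Real.exp (-(2 * x)) := by
    rw [← Real.exp_nat_mul]; simp
  rw [e] at h1
  refine h1.congr' ?_
  have h2 : Tendsto (fun n : ℕ => 1 - x / n / 2) atTop (𝓝 (1 - 0 / 2)) :=
    tendsto_const_nhds.sub ((tendsto_const_div_atTop_nhds_zero_nat x).div_const 2)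
  have h3 : ∀ᶠ n : ℕ in atTop, 1 - x / n / 2 ≠ 0 := h2.eventually_ne (by norm_num)
  filter_upwards [h3] with n hn
  rw [div_eq_iff hn, Finset.sum_range_reflect (fun i => 2 * ((1 - x / n) ^ i) ^ 2 * (x / n)),
    ← Finset.sum_mul, ← Finset.mul_sum]
  have := mul_geom_sum ((1 - x / n) ^ 2) n
  simp_rw [← pow_mul, mul_comm _ 2, pow_mul]
  linear_combination this

namespace IsOrnsteinUhlenbeck

variable {Ω : Type*} [MeasurableSpace Ω] {P : Measure Ω} [IsProbabilityMeasure P]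
  {θ : ℝ} {W Y : ℝ≥0 → Ω → ℝ}

lemma charFun_map_add (hY : IsOrnsteinUhlenbeck θ W Y P) (hθ : 0 < θ) (t : ℝ≥0) (u v : ℝ) :
    charFun (P.map (fun ω => u * Y 0 ω + v * Y t ω)) 1
      = charFun (P.map (Y 0)) (u + v * Real.exp (-(θ * t)))
        * Complex.exp (-(v ^ 2 * (1 - Real.exp (-(2 * (θ * t)))) / 2 : ℝ)) := by
  have hW := hY.isBrownian.toIsPreBrownianReal
  have hWm := hW.aemeasurable
  have hY0 := hY.aemeasurable 0
  set a : ℕ → ℝ := fun n => 1 - θ * t / n with ha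
  set τ : ℕ → ℕ → ℝ≥0 := fun n i => (i : ℕ) * t / n with hτ
  set S : ℕ → Ω → ℝ := fun n ω => ∑ i ∈ Finset.range n,
    (v * √(2 * θ) * a n ^ (n - 1 - i)) * (W (τ n (i + 1)) ω - W (τ n i) ω) with hS
  set vr : ℕ → ℝ := fun n => v ^ 2 * ∑ i ∈ Finset.range n,
    2 * ((1 - θ * t / n) ^ (n - 1 - i)) ^ 2 * (θ * t / n)
  have hSlaw : ∀ n u, charFun (P.map (S n)) u = Complex.exp (-(vr n * u ^ 2 / 2 : ℝ)) := by
    intro n u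
    have hmono : Monotone (τ n) := by
      intro i j hij
      simp only [hτ]
      gcongr
    have hind := hW.hasIndepIncrements.nat hmono
    have hl : ∀ i, HasLaw (fun ω => W (τ n (i + 1)) ω - W (τ n i) ω) (gaussianReal 0 (t / n)) P := by
      intro i
      have := hW.hasLaw_sub (τ n (i + 1)) (τ n i)
      have e : nndist (τ n (i + 1)).1 (τ n i).1 = t / n := by
        ext
        rw [coe_nndist, Real.dist_eq]
        have : ((τ n (i + 1)).1 - (τ n i).1 : ℝ) = t / n := by
          simp only [hτ, NNReal.val_eq_coe]
          push_cast
          ring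
        rw [this, abs_of_nonneg (by positivity)]
        simp
      rw [e] at this
      exact this
    have := map_sum_mul_gaussianReal hind hl
      (fun i => v * √(2 * θ) * a n ^ (n - 1 - i)) (Finset.range n)
    rw [this.map_eq, charFun_gaussianReal]
    congr 1
    have e : ((∑ i ∈ Finset.range n, NNReal.mk ((v * √(2 * θ) * a n ^ (n - 1 - i)) ^ 2)
        (sq_nonneg _) * (t / n) : ℝ≥0) : ℝ) = vr n := by
      simp only [vr]
      rw [NNReal.coe_sum, Finset.mul_sum]
      refine Finset.sum_congr rfl fun i _ => ?_
      rw [NNReal.coe_mul, NNReal.coe_mk, mul_pow, mul_pow, Real.sq_sqrt (by positivity)]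
      push_cast
      ring
    rw [← e]
    push_cast
    ring
  have hSm : ∀ n, AEMeasurable (S n) P := by
    intro n
    refine Finset.aemeasurable_fun_sum _ fun i _ => ?_
    exact ((hWm _).sub (hWm _)).const_mul _
  have hind : ∀ n, IndepFun (fun ω => (u + v * a n ^ n) * Y 0 ω) (S n) P := by
    intro n
    have := hY.indep_initial.comp (φ := fun x : ℝ => (u + v * a n ^ n) * x)
      (ψ := fun w : ℝ≥0 → ℝ => ∑ i ∈ Finset.range n,
        (v * √(2 * θ) * a n ^ (n - 1 - i)) * (w (τ n (i + 1)) - w (τ n i)))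
      (by fun_prop) (by fun_prop)
    exact this
  have hlim := tendsto_charFun_of_ae_tendsto (P := P)
    (X := fun n ω => (u + v * a n ^ n) * Y 0 ω + S n ω)
    (Z := fun ω => u * Y 0 ω + v * Y t ω)
    (fun n => (hY0.const_mul _).add (hSm n)) ((hY0.const_mul _).add ((hY.aemeasurable t).const_mul _))
    (by
      filter_upwards [hY.continuous_paths, hY.integral_equation] with ω h1 h2
      have := tendsto_euler_scheme hθ h1 h2 t
      refine ((tendsto_const_nhds (x := u * Y 0 ω)).add (this.const_mul v)).congr fun n => ?_
      simp only [hS, ha, hτ]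
      simp_rw [mul_assoc (v * √(2 * θ))]
      rw [← Finset.mul_sum]
      ring) 1
  have hlim2 : Tendsto (fun n => charFun (P.map (fun ω => (u + v * a n ^ n) * Y 0 ω + S n ω)) 1)
      atTop (𝓝 (charFun (P.map (Y 0)) (u + v * Real.exp (-(θ * t)))
        * Complex.exp (-(v ^ 2 * (1 - Real.exp (-(2 * (θ * t)))) / 2 : ℝ)))) := by
    have e : ∀ n, charFun (P.map (fun ω => (u + v * a n ^ n) * Y 0 ω + S n ω)) 1
        = charFun (P.map (Y 0)) (u + v * a n ^ n) * Complex.exp (-(vr n / 2 : ℝ)) := by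
      intro n
      rw [(hind n).charFun_map_fun_add_eq_mul (hY0.const_mul _) (hSm n), Pi.mul_apply, hSlaw,
        charFun_map_mul_comp hY0]
      simp
    simp_rw [e]
    have : IsProbabilityMeasure (P.map (Y 0)) := Measure.isProbabilityMeasure_map hY0
    refine Tendsto.mul ?_ ?_
    · exact ((continuous_charFun (μ := P.map (Y 0))).tendsto _).comp
        (tendsto_const_nhds.add ((tendsto_one_sub_div_pow_exp (θ * t)).const_mul v))
    · exact ((Continuous.tendsto (f := fun x : ℝ => Complex.exp (-(x / 2 : ℝ))) (by fun_prop)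
        _).comp ((tendsto_geom_sum_euler (θ * t)).const_mul (v ^ 2)))
  exact tendsto_nhds_unique hlim hlim2

lemma hasLaw_zero (hY : IsOrnsteinUhlenbeck θ W Y P) (hstat : IsStationaryProcess Y P)
    (hθ : 0 < θ) : HasLaw (Y 0) (gaussianReal 0 1) P := by
  have hY0 := hY.aemeasurable 0
  have : IsProbabilityMeasure (P.map (Y 0)) := Measure.isProbabilityMeasure_map hY0
  refine ⟨hY0, Measure.ext_of_charFun ?_⟩
  ext v
  have hshift : ∀ t : ℝ≥0, P.map (Y t) = P.map (Y 0) := by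
    intro t
    have := (hstat.identDistrib_shift t {0}).comp
      (u := fun x : ({0} : Finset ℝ≥0) → ℝ => x ⟨0, by simp⟩) (measurable_pi_apply _)
    simpa [Function.comp_def] using this.map_eq
  have h1 : ∀ t : ℝ≥0, charFun (P.map (Y 0)) v = charFun (P.map (Y 0)) (v * Real.exp (-(θ * t)))
        * Complex.exp (-(v ^ 2 * (1 - Real.exp (-(2 * (θ * t)))) / 2 : ℝ)) := by
    intro t
    have := hY.charFun_map_add hθ t 0 v
    simp only [zero_mul, zero_add] at this
    rw [charFun_map_mul_comp (hY.aemeasurable t), mul_one, hshift] at this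
    exact this
  have hexp : ∀ c : ℝ, 0 < c → Tendsto (fun n : ℕ => Real.exp (-(c * n))) atTop (𝓝 0) := by
    intro c hc
    exact Real.tendsto_exp_neg_atTop_nhds_zero.comp
      (tendsto_natCast_atTop_atTop.const_mul_atTop hc)
  have h2 : Tendsto (fun n : ℕ => charFun (P.map (Y 0)) (v * Real.exp (-(θ * n)))
        * Complex.exp (-(v ^ 2 * (1 - Real.exp (-(2 * θ * n))) / 2 : ℝ))) atTop
      (𝓝 (charFun (P.map (Y 0)) (v * 0) * Complex.exp (-(v ^ 2 * (1 - 0) / 2 : ℝ)))) := by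
    refine Tendsto.mul ?_ ?_
    · exact ((continuous_charFun (μ := P.map (Y 0))).tendsto _).comp ((hexp θ hθ).const_mul v)
    · exact (Continuous.tendsto (f := fun x : ℝ => Complex.exp (-(v ^ 2 * (1 - x) / 2 : ℝ)))
        (by fun_prop) _).comp (hexp (2 * θ) (by positivity))
  have h3 := tendsto_nhds_unique (tendsto_const_nhds (x := charFun (P.map (Y 0)) v))
    (h2.congr fun n => by
      have := h1 n
      rw [NNReal.coe_natCast, ← mul_assoc 2] at this
      exact this.symm)
  rw [h3, charFun_gaussianReal]
  simp

/-- The joint law of a stationary Ornstein–Uhlenbeck process at times `0` and `t`. -/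
lemma map_prodMk (hY : IsOrnsteinUhlenbeck θ W Y P) (hstat : IsStationaryProcess Y P)
    (hθ : 0 < θ) (t : ℝ≥0) :
    P.map (fun ω => (Y 0 ω, Y t ω)) = ((gaussianReal 0 1).prod (gaussianReal 0 1)).map
      (fun p : ℝ × ℝ => (p.1, Real.exp (-(θ * t)) * p.1
        + √(1 - Real.exp (-(θ * t)) ^ 2) * p.2)) := by
  have hY0 := hY.aemeasurable 0
  have hYt := hY.aemeasurable t
  have : IsProbabilityMeasure (P.map (fun ω => (Y 0 ω, Y t ω))) :=
    Measure.isProbabilityMeasure_map (hY0.prodMk hYt)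
  set ρ := Real.exp (-(θ * t)) with hρ
  have hρ1 : ρ ≤ 1 := by rw [hρ, Real.exp_le_one_iff]; have := t.2; simp; positivity
  have hρ0 : 0 < ρ := Real.exp_pos _
  have hρ2 : Real.exp (-(2 * (θ * t))) = ρ ^ 2 := by
    rw [hρ, ← Real.exp_nat_mul]; congr 1; push_cast; ring
  have hf : Measurable (fun p : ℝ × ℝ => (p.1, ρ * p.1 + √(1 - ρ ^ 2) * p.2)) := by fun_prop
  have : IsProbabilityMeasure (((gaussianReal 0 1).prod (gaussianReal 0 1)).map
      (fun p : ℝ × ℝ => (p.1, ρ * p.1 + √(1 - ρ ^ 2) * p.2))) :=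
    Measure.isProbabilityMeasure_map hf.aemeasurable
  refine Measure.ext_of_charFunDual ?_
  ext L
  set u := L (1, 0)
  set v := L (0, 1)
  have hL : ∀ x y : ℝ, L (x, y) = u * x + v * y := by
    intro x y
    have : ((x, y) : ℝ × ℝ) = x • (1, 0) + y • (0, 1) := by simp
    rw [this, map_add, map_smul, map_smul, smul_eq_mul, smul_eq_mul]
    ring
  rw [charFunDual_apply, charFunDual_apply, integral_map (hY0.prodMk hYt)
    (Continuous.aestronglyMeasurable (by fun_prop)), integral_map hf.aemeasurable
    (Continuous.aestronglyMeasurable (by fun_prop))]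
  have h1 := hY.charFun_map_add hθ t u v
  have hm : AEMeasurable (fun ω => u * Y 0 ω + v * Y t ω) P :=
    (hY0.const_mul _).add (hYt.const_mul _)
  rw [charFun_apply_real, integral_map hm
    (Continuous.aestronglyMeasurable (by fun_prop)), (hY.hasLaw_zero hstat hθ).map_eq,
    charFun_gaussianReal, hρ2, ← hρ] at h1
  have e1 : ∫ ω, Complex.exp (L (Y 0 ω, Y t ω) * Complex.I) ∂P
      = Complex.exp (-((u + v * ρ) ^ 2 / 2 : ℝ)) *
        Complex.exp (-(v ^ 2 * (1 - ρ ^ 2) / 2 : ℝ)) := by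
    convert h1 using 1
    · simp [hL]
    · congr 2
      push_cast
      simp
  rw [e1]
  have e2 : ∀ p : ℝ × ℝ, Complex.exp (L (p.1, ρ * p.1 + √(1 - ρ ^ 2) * p.2) * Complex.I)
      = Complex.exp ((u + v * ρ : ℝ) * p.1 * Complex.I)
        * Complex.exp ((v * √(1 - ρ ^ 2) : ℝ) * p.2 * Complex.I) := by
    intro p
    rw [hL, ← Complex.exp_add]
    congr 1
    push_cast
    ring
  simp_rw [e2]
  rw [integral_prod_mul (fun x : ℝ => Complex.exp ((u + v * ρ : ℝ) * x * Complex.I))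
    (fun x : ℝ => Complex.exp ((v * √(1 - ρ ^ 2) : ℝ) * x * Complex.I)),
    ← charFun_apply_real, ← charFun_apply_real, charFun_gaussianReal, charFun_gaussianReal]
  congr 2
  · push_cast; simp [hρ]
  · have : (v * √(1 - ρ ^ 2)) ^ 2 = v ^ 2 * (1 - ρ ^ 2) := by
      rw [mul_pow, Real.sq_sqrt (by nlinarith)]
    rw [← this]; push_cast; simp

end IsOrnsteinUhlenbeck

/-- The coefficient of `x ^ (2 * j + 2)` in the Taylor expansion of `arcsin x ^ 2`. -/
noncomputable def arcsinSqCoeff (j : ℕ) : ℝ :=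
  2 ^ (2 * j + 1) * (j.factorial : ℝ) ^ 2 / (2 * j + 2).factorial

lemma arcsinSqCoeff_pos (j : ℕ) : 0 < arcsinSqCoeff j := by
  unfold arcsinSqCoeff
  positivity

lemma arcsinSqCoeff_succ (j : ℕ) :
    arcsinSqCoeff (j + 1) * ((2 * j + 4) * (2 * j + 3)) = arcsinSqCoeff j * (2 * j + 2) ^ 2 := by
  unfold arcsinSqCoeff
  rw [show 2 * (j + 1) + 2 = 2 * j + 2 + 1 + 1 by ring, Nat.factorial_succ (2 * j + 2 + 1),
    Nat.factorial_succ (2 * j + 2), Nat.factorial_succ j]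
  push_cast
  have : ((2 * j + 2).factorial : ℝ) ≠ 0 := by positivity
  field_simp
  ring

lemma nonneg_of_hasDerivAt {f f' : ℝ → ℝ} {b : ℝ} (h0 : f 0 = 0)
    (hf : ∀ x, HasDerivAt f (f' x) x) (hf' : ∀ x ∈ Set.Icc 0 b, 0 ≤ f' x) :
    ∀ x ∈ Set.Icc 0 b, 0 ≤ f x := by
  intro x hx
  have hm : MonotoneOn f (Set.Icc 0 b) := by
    refine monotoneOn_of_deriv_nonneg (convex_Icc 0 b)
      (fun y _ => (hf y).continuousAt.continuousWithinAt)
      (fun y _ => (hf y).differentiableAt.differentiableWithinAt) fun y hy => ?_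
    rw [(hf y).deriv]
    exact hf' y (interior_subset hy)
  rw [← h0]
  exact hm ⟨le_rfl, hx.1.trans hx.2⟩ hx hx.1

lemma sin_sq_sum_bounds (N : ℕ) {x : ℝ} (hx0 : 0 ≤ x) (hx : x < Real.pi / 2) :
    0 ≤ x ^ 2 - ∑ j ∈ Finset.range N, arcsinSqCoeff j * Real.sin x ^ (2 * j + 2) ∧
    x ^ 2 - ∑ j ∈ Finset.range N, arcsinSqCoeff j * Real.sin x ^ (2 * j + 2)
      ≤ arcsinSqCoeff N * ((2 * N + 2) * (2 * N + 1)) * Real.sin x ^ (2 * N) * x ^ 2 / 2 := by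
  set r : ℕ → ℝ := fun N => arcsinSqCoeff N * ((2 * N + 2) * (2 * N + 1)) with hr
  have hr0 : r 0 = 2 := by simp [hr, arcsinSqCoeff]
  have hrs : ∀ N, r (N + 1) = arcsinSqCoeff N * (2 * N + 2) ^ 2 := by
    intro N
    rw [← arcsinSqCoeff_succ]
    simp only [hr]
    push_cast
    ring
  set D : ℝ → ℝ := fun y => y ^ 2 - ∑ j ∈ Finset.range N, arcsinSqCoeff j * Real.sin y ^ (2 * j + 2)
  set D' : ℝ → ℝ := fun y => 2 * y - ∑ j ∈ Finset.range N,
    arcsinSqCoeff j * ((2 * j + 2) * Real.sin y ^ (2 * j + 1) * Real.cos y)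
  have hD : ∀ y, HasDerivAt D (D' y) y := by
    intro y
    refine HasDerivAt.sub (by simpa using hasDerivAt_pow 2 y) ?_
    refine HasDerivAt.fun_sum fun j _ => ?_
    have := ((Real.hasDerivAt_sin y).pow (2 * j + 2)).const_mul (arcsinSqCoeff j)
    simpa [add_assoc] using this
  have hD2 : ∀ y, HasDerivAt D' (r N * Real.sin y ^ (2 * N)) y := by
    intro y
    have e : r N * Real.sin y ^ (2 * N) = 2 * 1 - ∑ j ∈ Finset.range N,
        arcsinSqCoeff j * ((2 * j + 2) * ((2 * j + 1) * Real.sin y ^ (2 * j) * Real.cos y)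
          * Real.cos y + (2 * j + 2) * Real.sin y ^ (2 * j + 1) * -Real.sin y) := by
      clear_value D D'
      induction N with
      | zero => simp [hr0]
      | succ N ih =>
        rw [Finset.sum_range_succ, ← sub_sub, ← ih, hrs]
        simp only [hr]
        have := Real.sin_sq_add_cos_sq y
        have hc : Real.cos y ^ 2 = 1 - Real.sin y ^ 2 := by linarith
        have hc2 : ∀ A : ℝ, A * Real.cos y * Real.cos y = A * (1 - Real.sin y ^ 2) := by
          intro A; rw [← hc]; ring
        ring_nf
        rw [hc]
        ring
    rw [e]
    refine HasDerivAt.sub ((hasDerivAt_id y).const_mul 2) ?_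
    refine HasDerivAt.fun_sum fun j _ => ?_
    have h1 := ((Real.hasDerivAt_sin y).pow (2 * j + 1)).const_mul (2 * (j : ℝ) + 2)
    have := (h1.mul (Real.hasDerivAt_cos y)).const_mul (arcsinSqCoeff j)
    simpa using this
  have hrN : 0 ≤ r N := by
    have := arcsinSqCoeff_pos N
    simp only [hr]
    positivity
  have hsin : ∀ y ∈ Set.Icc 0 x, 0 ≤ Real.sin y ∧ Real.sin y ≤ Real.sin x := by
    intro y hy
    exact ⟨Real.sin_nonneg_of_nonneg_of_le_pi hy.1 (by linarith [hy.2, Real.pi_pos]),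
      Real.sin_le_sin_of_le_of_le_pi_div_two (by linarith [hy.1, Real.pi_pos]) hx.le hy.2⟩
  set M := r N * Real.sin x ^ (2 * N) with hM
  have h1 := nonneg_of_hasDerivAt (f := D') (b := x) (by simp [D']) hD2 (fun y hy =>
    mul_nonneg hrN (pow_nonneg (hsin y hy).1 _))
  have h2 := nonneg_of_hasDerivAt (f := D) (b := x) (by simp [D]) hD h1
  have h3 := nonneg_of_hasDerivAt (f := fun y => M * y - D' y) (b := x) (by simp [D'])
    (fun y => ((hasDerivAt_id y).const_mul M).sub (hD2 y)) (fun y hy => by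
      have : Real.sin y ^ (2 * N) ≤ Real.sin x ^ (2 * N) :=
        pow_le_pow_left₀ (hsin y hy).1 (hsin y hy).2 _
      have := mul_le_mul_of_nonneg_left this hrN
      simp only [hM]
      linarith)
  have h4 := nonneg_of_hasDerivAt (f := fun y => M * (y ^ 2 / 2) - D y) (b := x) (by simp [D])
    (f' := fun y => M * y - D' y)
    (fun y => by
      refine HasDerivAt.sub (HasDerivAt.const_mul M ?_) (hD y)
      simpa using (hasDerivAt_pow 2 y).div_const 2) h3
  have hxm : x ∈ Set.Icc 0 x := ⟨hx0, le_rfl⟩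
  refine ⟨h2 x hxm, ?_⟩
  have := h4 x hxm
  simp only [D] at this
  linarith

lemma arcsinSqCoeff_mul_le (N : ℕ) :
    arcsinSqCoeff N * ((2 * N + 2) * (2 * N + 1)) ≤ 2 * (2 * N + 1) := by
  induction N with
  | zero => simp [arcsinSqCoeff]
  | succ N ih =>
    have h := arcsinSqCoeff_succ N
    have e : arcsinSqCoeff (N + 1) * ((2 * ((N + 1 : ℕ) : ℝ) + 2) * (2 * ((N + 1 : ℕ) : ℝ) + 1))
        = arcsinSqCoeff N * (2 * N + 2) ^ 2 := by
      rw [← h]; push_cast; ring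
    rw [e]
    have h2 : arcsinSqCoeff N * (2 * N + 2) ≤ 2 := by
      have : 0 < 2 * (N : ℝ) + 1 := by positivity
      refine le_of_mul_le_mul_right ?_ this
      linarith
    push_cast
    have h3 : (0 : ℝ) ≤ 2 * N + 2 := by positivity
    calc arcsinSqCoeff N * (2 * N + 2) ^ 2 = arcsinSqCoeff N * (2 * N + 2) * (2 * N + 2) := by ring
      _ ≤ 2 * (2 * N + 2) := by gcongr
      _ ≤ _ := by linarith

lemma hasSum_arcsinSqCoeff_mul_sin {x : ℝ} (hx0 : 0 ≤ x) (hx : x < Real.pi / 2) :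
    HasSum (fun j => arcsinSqCoeff j * Real.sin x ^ (2 * j + 2)) (x ^ 2) := by
  have hs0 : 0 ≤ Real.sin x := Real.sin_nonneg_of_nonneg_of_le_pi hx0 (by linarith)
  have hs1 : Real.sin x < 1 := by
    rw [← Real.sin_pi_div_two]
    exact Real.sin_lt_sin_of_lt_of_le_pi_div_two (by linarith [Real.pi_pos]) le_rfl hx
  rw [hasSum_iff_tendsto_nat_of_nonneg fun j => by have := arcsinSqCoeff_pos j; positivity]
  have hlim : Tendsto (fun N : ℕ => x ^ 2 * (2 * (N * (Real.sin x ^ 2) ^ N) + (Real.sin x ^ 2) ^ N))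
      atTop (𝓝 (x ^ 2 * (2 * 0 + 0))) := by
    have hq : Real.sin x ^ 2 < 1 := by nlinarith
    refine ((Tendsto.const_mul 2 ?_).add ?_).const_mul _
    · exact tendsto_self_mul_const_pow_of_lt_one (by positivity) hq
    · exact tendsto_pow_atTop_nhds_zero_of_lt_one (by positivity) hq
  have hD : Tendsto (fun N => x ^ 2 - ∑ j ∈ Finset.range N,
      arcsinSqCoeff j * Real.sin x ^ (2 * j + 2)) atTop (𝓝 0) := by
    refine tendsto_of_tendsto_of_tendsto_of_le_of_le tendsto_const_nhds (by simpa using hlim)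
      (fun N => (sin_sq_sum_bounds N hx0 hx).1) fun N => ?_
    refine (sin_sq_sum_bounds N hx0 hx).2.trans ?_
    have := mul_le_mul_of_nonneg_right (arcsinSqCoeff_mul_le N)
      (show 0 ≤ Real.sin x ^ (2 * N) * x ^ 2 / 2 by positivity)
    rw [← pow_mul]
    linarith
  have := (tendsto_const_nhds (x := x ^ 2)).sub hD
  simpa using this

/-- `log |1 - r e ^ {2 i x}|`, the Abel regularisation of `log |2 sin x|`. -/
noncomputable def abelLogSin (r x : ℝ) : ℝ := Real.log (1 - 2 * r * Real.cos (2 * x) + r ^ 2) / 2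

lemma abelLogSin_one (x : ℝ) : abelLogSin 1 x = Real.log (2 * Real.sin x) := by
  have : 1 - 2 * 1 * Real.cos (2 * x) + 1 ^ 2 = (2 * Real.sin x) ^ 2 := by
    rw [Real.cos_two_mul, Real.cos_sq']; ring
  rw [abelLogSin, this, Real.log_pow]
  push_cast
  ring

lemma hasSum_abelLogSin {r : ℝ} (hr0 : 0 ≤ r) (hr1 : r < 1) (x : ℝ) :
    HasSum (fun k : ℕ => r ^ (k + 1) / (k + 1) * Real.cos (2 * (k + 1) * x))
      (-abelLogSin r x) := by
  set z : ℂ := r * Complex.exp ((2 * x : ℝ) * Complex.I) with hz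
  have hnz : ‖z‖ = r := by
    rw [hz, norm_mul, Complex.norm_exp_ofReal_mul_I, mul_one, Complex.norm_real,
      Real.norm_of_nonneg hr0]
  have h := Complex.hasSum_re (Complex.hasSum_taylorSeries_neg_log' (z := z) (by rwa [hnz]))
  have e1 : (-Complex.log (1 - z)).re = -abelLogSin r x := by
    rw [Complex.neg_re, Complex.log_re, abelLogSin]
    have : 1 - 2 * r * Real.cos (2 * x) + r ^ 2 = ‖1 - z‖ ^ 2 := by
      rw [← Complex.normSq_eq_norm_sq, Complex.normSq_apply, hz, Complex.exp_mul_I,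
        ← Complex.ofReal_cos, ← Complex.ofReal_sin]
      simp only [Complex.sub_re, Complex.one_re, Complex.mul_re, Complex.ofReal_re,
        Complex.add_re, Complex.I_re, Complex.ofReal_im, Complex.I_im, Complex.add_im,
        Complex.mul_im, Complex.sub_im, Complex.one_im]
      have := Real.sin_sq_add_cos_sq (2 * x)
      linear_combination (-r ^ 2) * this
    rw [this, Real.log_pow]
    push_cast
    ring
  rw [e1] at h
  refine h.congr_fun ?_
  intro k
  have : z ^ (k + 1) / (k + 1) = ((r ^ (k + 1) / (k + 1) : ℝ) : ℂ) *
      Complex.exp ((2 * (k + 1) * x : ℝ) * Complex.I) := by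
    rw [hz, mul_pow, ← Complex.exp_nat_mul]
    push_cast
    rw [mul_div_right_comm]
    congr 2
    ring
  rw [this, Complex.re_ofReal_mul, Complex.exp_ofReal_mul_I_re]

lemma abs_abelLogSin_le {r x : ℝ} (hr0 : 1 / 2 ≤ r) (hr1 : r ≤ 1) (hx : Real.sin x ≠ 0) :
    |abelLogSin r x| ≤ |Real.log (Real.sin x)| + Real.log 2 := by
  have hs : 0 < Real.sin x ^ 2 := by positivity
  have e : 1 - 2 * r * Real.cos (2 * x) + r ^ 2 = (1 - r) ^ 2 + 4 * r * Real.sin x ^ 2 := by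
    rw [Real.cos_two_mul, Real.cos_sq']; ring
  have hs1 := Real.sin_sq_le_one x
  have h1 : Real.sin x ^ 2 ≤ (1 - r) ^ 2 + 4 * r * Real.sin x ^ 2 := by nlinarith
  have h2 : (1 - r) ^ 2 + 4 * r * Real.sin x ^ 2 ≤ 2 ^ 2 := by nlinarith
  have h3 := Real.log_le_log hs h1
  have h4 := Real.log_le_log (hs.trans_le h1) h2
  rw [Real.log_pow] at h3 h4
  push_cast at h3 h4
  have := Real.log_pos (one_lt_two)
  rw [abelLogSin, e, abs_le]
  constructor
  · linarith [neg_abs_le (Real.log (Real.sin x))]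
  · linarith [abs_nonneg (Real.log (Real.sin x))]

lemma sq_log_le {s : ℝ} (h0 : 0 < s) (h1 : s ≤ 1) : Real.log s ^ 2 ≤ 16 * s ^ (-(1 / 2) : ℝ) := by
  have h := Real.abs_log_mul_self_rpow_lt s (1 / 4) h0 h1 (by norm_num)
  have h2 : (Real.log s * s ^ (1 / 4 : ℝ)) ^ 2 ≤ 16 := by
    rw [← sq_abs]
    calc _ ≤ (1 / (1 / 4) : ℝ) ^ 2 := by gcongr
      _ = 16 := by norm_num
  have e : (s ^ (1 / 4 : ℝ)) ^ 2 = s ^ (1 / 2 : ℝ) := by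
    rw [← Real.rpow_natCast, ← Real.rpow_mul h0.le]; norm_num
  rw [mul_pow, e] at h2
  rw [Real.rpow_neg h0.le, ← div_eq_mul_inv, le_div_iff₀ (by positivity)]
  exact h2

lemma memLp_log_sin : MemLp (fun x => Real.log (Real.sin x)) 2
    (volume.restrict (Set.Ioc 0 Real.pi)) := by
  have hm : Measurable (fun x => Real.log (Real.sin x)) := by fun_prop
  rw [memLp_two_iff_integrable_sq hm.aestronglyMeasurable]
  have h1 : IntervalIntegrable (fun x : ℝ => x ^ (-(1 / 2) : ℝ)) volume 0 (Real.pi / 2) :=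
    intervalIntegral.intervalIntegrable_rpow' (by norm_num)
  have h2 : IntervalIntegrable (fun x : ℝ => (x / 2) ^ (-(1 / 2) : ℝ)) volume 0 Real.pi := by
    have := h1.comp_mul_left (c := 2⁻¹)
    simpa [div_eq_inv_mul] using this
  have h3 : IntervalIntegrable (fun x : ℝ => ((Real.pi - x) / 2) ^ (-(1 / 2) : ℝ)) volume 0 Real.pi := by
    have := (h2.comp_sub_left Real.pi).symm
    simpa using this
  have h4 := (intervalIntegrable_iff_integrableOn_Ioc_of_le Real.pi_pos.le).1
    ((h2.add h3).const_mul 16)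
  refine Integrable.mono' h4 (hm.pow_const 2).aestronglyMeasurable ?_
  rw [Measure.restrict_congr_set Ioo_ae_eq_Ioc.symm]
  filter_upwards [ae_restrict_mem measurableSet_Ioo] with x hx
  rw [Real.norm_of_nonneg (by positivity)]
  have hs := Real.sin_pos_of_pos_of_lt_pi hx.1 hx.2
  refine (sq_log_le hs (Real.sin_le_one x)).trans ?_
  have hpi := Real.pi_pos
  have key : ∀ y : ℝ, 0 < y → y ≤ Real.pi / 2 → Real.sin y ^ (-(1 / 2) : ℝ)
      ≤ (y / 2) ^ (-(1 / 2) : ℝ) := by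
    intro y hy0 hy1
    refine Real.rpow_le_rpow_of_nonpos (by positivity) ?_ (by norm_num)
    refine le_trans ?_ (Real.mul_le_sin hy0.le hy1)
    rw [div_mul_eq_mul_div, le_div_iff₀ hpi]
    nlinarith [Real.pi_le_four]
  have p1 : 0 ≤ (x / 2) ^ (-(1 / 2) : ℝ) := Real.rpow_nonneg (by linarith [hx.1]) _
  have p2 : 0 ≤ ((Real.pi - x) / 2) ^ (-(1 / 2) : ℝ) := Real.rpow_nonneg (by linarith [hx.2]) _
  rcases le_total x (Real.pi / 2) with h | h
  · linarith [key x hx.1 h]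
  · have := key (Real.pi - x) (by linarith [hx.2]) (by linarith)
    rw [Real.sin_pi_sub] at this
    linarith

lemma ae_sin_ne_zero : ∀ᵐ x ∂(volume.restrict (Set.Ioc 0 Real.pi)), Real.sin x ≠ 0 := by
  rw [Measure.restrict_congr_set Ioo_ae_eq_Ioc.symm]
  filter_upwards [ae_restrict_mem measurableSet_Ioo] with x hx
  exact (Real.sin_pos_of_pos_of_lt_pi hx.1 hx.2).ne'

/-- Pairing a square integrable function with the Fourier series of `log |2 sin x|`. -/
lemma hasSum_integral_mul_cos_of_summable {f : ℝ → ℝ}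
    (hf : MemLp f 2 (volume.restrict (Set.Ioc 0 Real.pi)))
    (hs : Summable (fun k : ℕ => 1 / ((k : ℝ) + 1) *
      ∫ x in (0 : ℝ)..Real.pi, f x * Real.cos (2 * (k + 1) * x))) :
    HasSum (fun k : ℕ => 1 / ((k : ℝ) + 1) *
      ∫ x in (0 : ℝ)..Real.pi, f x * Real.cos (2 * (k + 1) * x))
      (-∫ x in (0 : ℝ)..Real.pi, f x * Real.log (2 * Real.sin x)) := by
  set μ := volume.restrict (Set.Ioc 0 Real.pi) with hμ
  have hfi : Integrable f μ := hf.integrable (by norm_num)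
  simp only [intervalIntegral.integral_of_le Real.pi_pos.le] at hs ⊢
  rw [← hμ] at hs ⊢
  set c : ℕ → ℝ := fun k => 1 / ((k : ℝ) + 1) * ∫ x, f x * Real.cos (2 * (k + 1) * x) ∂μ with hc
  have hsum : ∀ r : ℝ, 0 ≤ r → r < 1 →
      HasSum (fun k => r ^ (k + 1) * c k) (∫ x, f x * -abelLogSin r x ∂μ) := by
    intro r hr0 hr1
    have hint : ∀ k : ℕ, Integrable (fun x => f x *
        (r ^ (k + 1) / (k + 1) * Real.cos (2 * (k + 1) * x))) μ := by
      intro k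
      refine hfi.mul_bdd (c := r ^ (k + 1) / (k + 1)) (by fun_prop) (ae_of_all _ fun x => ?_)
      rw [norm_mul, Real.norm_of_nonneg (by positivity)]
      exact mul_le_of_le_one_right (by positivity) (Real.abs_cos_le_one _)
    have h := hasSum_integral_of_summable_integral_norm (F := fun (k : ℕ) x => f x *
        (r ^ (k + 1) / (k + 1) * Real.cos (2 * (k + 1) * x))) (μ := μ) hint ?_
    · have e : ∀ x, ∑' k : ℕ, f x * (r ^ (k + 1) / (k + 1) * Real.cos (2 * (k + 1) * x))
          = f x * -abelLogSin r x := fun x => ((hasSum_abelLogSin hr0 hr1 x).mul_left _).tsum_eq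
      simp_rw [e] at h
      refine h.congr_fun fun k => ?_
      simp only [hc]
      rw [← mul_assoc, mul_one_div, ← integral_const_mul]
      congr 1 with x
      ring
    · refine Summable.of_nonneg_of_le (fun k => integral_nonneg fun x => norm_nonneg _)
        (fun k => ?_) ((summable_geometric_of_lt_one hr0 hr1).mul_left (∫ x, ‖f x‖ ∂μ))
      rw [← integral_mul_const]
      refine integral_mono (hint k).norm (hfi.norm.mul_const _) fun x => ?_
      simp only [norm_mul]
      gcongr
      rw [Real.norm_of_nonneg (by positivity : (0 : ℝ) ≤ r ^ (k + 1) / (k + 1))]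
      calc r ^ (k + 1) / (k + 1) * ‖Real.cos (2 * (k + 1) * x)‖ ≤ r ^ (k + 1) / (k + 1) * 1 := by
            gcongr; exact Real.abs_cos_le_one _
        _ ≤ r ^ (k + 1) / 1 := by
            rw [mul_one]; gcongr; linarith [(Nat.cast_nonneg k : (0 : ℝ) ≤ k)]
        _ ≤ r ^ k := by rw [div_one, pow_succ]; exact mul_le_of_le_one_right (by positivity) hr1.le
  have hr : Tendsto (fun n : ℕ => 1 - 1 / ((n : ℝ) + 2)) atTop (𝓝 1) := by
    have : Tendsto (fun n : ℕ => 1 / ((n : ℝ) + 2)) atTop (𝓝 0) := by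
      have := tendsto_one_div_add_atTop_nhds_zero_nat (𝕜 := ℝ)
      refine ((tendsto_add_atTop_iff_nat 1).2 this).congr fun n => ?_
      push_cast; ring_nf
    simpa using (tendsto_const_nhds (x := (1 : ℝ))).sub this
  have hr2 : ∀ n : ℕ, 1 / 2 ≤ 1 - 1 / ((n : ℝ) + 2) := by
    intro n
    have : 1 / ((n : ℝ) + 2) ≤ 1 / 2 := by gcongr; linarith [(Nat.cast_nonneg n : (0 : ℝ) ≤ n)]
    linarith
  have hr3 : ∀ n : ℕ, 1 - 1 / ((n : ℝ) + 2) < 1 := by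
    intro n
    have : 0 < 1 / ((n : ℝ) + 2) := by positivity
    linarith
  have hL : Tendsto (fun n : ℕ => ∫ x, f x * -abelLogSin (1 - 1 / ((n : ℝ) + 2)) x ∂μ) atTop
      (𝓝 (-∫ x, f x * Real.log (2 * Real.sin x) ∂μ)) := by
    rw [← integral_neg]
    have hmeas : ∀ r, Measurable (abelLogSin r) := by
      intro r; unfold abelLogSin; fun_prop
    refine tendsto_integral_of_dominated_convergence
      (fun x => ‖f x‖ * (|Real.log (Real.sin x)| + Real.log 2)) (fun n => ?_) ?_ (fun n => ?_) ?_
    · exact hf.1.mul (hmeas _).neg.aestronglyMeasurable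
    · exact hf.norm.integrable_mul (memLp_log_sin.abs.add (memLp_const _))
    · filter_upwards [ae_sin_ne_zero] with x hx
      rw [norm_mul, norm_neg]
      gcongr
      exact abs_abelLogSin_le (hr2 n) (hr3 n).le hx
    · filter_upwards [ae_sin_ne_zero] with x hx
      rw [← mul_neg, ← abelLogSin_one]
      refine Tendsto.const_mul _ (Tendsto.neg ?_)
      have hcont : ContinuousAt (fun r => abelLogSin r x) 1 := by
        unfold abelLogSin
        refine ContinuousAt.div_const (ContinuousAt.log (by fun_prop) ?_) _
        have : 1 - 2 * 1 * Real.cos (2 * x) + 1 ^ 2 = (2 * Real.sin x) ^ 2 := by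
          rw [Real.cos_two_mul, Real.cos_sq']; ring
        rw [this]
        positivity
      exact hcont.tendsto.comp hr
  have hR : Tendsto (fun n : ℕ => ∑' k, (1 - 1 / ((n : ℝ) + 2)) ^ (k + 1) * c k) atTop
      (𝓝 (∑' k, 1 ^ (k + 1) * c k)) := by
    refine tendsto_tsum_of_dominated_convergence hs.norm (fun k => ?_)
      (Eventually.of_forall fun n k => ?_)
    · exact (hr.pow (k + 1)).mul_const _
    · rw [norm_mul, norm_pow, Real.norm_of_nonneg (by linarith [hr2 n])]
      exact mul_le_of_le_one_left (norm_nonneg _) (pow_le_one₀ (by linarith [hr2 n]) (hr3 n).le)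
  have heq := tendsto_nhds_unique hL (hR.congr fun n =>
    (hsum _ (by linarith [hr2 n]) (hr3 n)).tsum_eq)
  rw [heq]
  simpa using hs.hasSum

lemma integral_cos_two_mul_int {m : ℤ} (hm : m ≠ 0) :
    ∫ x in (0 : ℝ)..Real.pi, Real.cos (2 * m * x) = 0 := by
  have h : (2 * (m : ℝ)) ≠ 0 := by simpa using hm
  rw [intervalIntegral.integral_comp_mul_left (fun x => Real.cos x) h, integral_cos]
  have : Real.sin (2 * m * Real.pi) = 0 := by
    have := Real.sin_int_mul_pi (2 * m)
    push_cast at this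
    exact this
  rw [this]
  simp

lemma integral_cos_mul_cos (j k : ℕ) :
    ∫ x in (0 : ℝ)..Real.pi, Real.cos (2 * (j + 1) * x) * Real.cos (2 * (k + 1) * x)
      = if k = j then Real.pi / 2 else 0 := by
  have e : ∀ x : ℝ, Real.cos (2 * (j + 1) * x) * Real.cos (2 * (k + 1) * x)
      = (Real.cos (2 * ((j - k : ℤ) : ℝ) * x) + Real.cos (2 * ((j + k + 2 : ℤ) : ℝ) * x)) / 2 := by
    intro x
    have h1 : (2 * ((j - k : ℤ) : ℝ) * x) = 2 * (j + 1) * x - 2 * (k + 1) * x := by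
      push_cast; ring
    have h2 : (2 * ((j + k + 2 : ℤ) : ℝ) * x) = 2 * (j + 1) * x + 2 * (k + 1) * x := by
      push_cast; ring
    rw [h1, h2, Real.cos_sub, Real.cos_add]
    ring
  simp_rw [e]
  rw [intervalIntegral.integral_div, intervalIntegral.integral_add
    (Continuous.intervalIntegrable (by fun_prop) _ _)
    (Continuous.intervalIntegrable (by fun_prop) _ _),
    integral_cos_two_mul_int (by omega : (j + k + 2 : ℤ) ≠ 0)]
  split_ifs with h
  · simp [h]
  · rw [integral_cos_two_mul_int (by omega)]
    simp

lemma memLp_two_of_continuous {f : ℝ → ℝ} (hf : Continuous f) :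
    MemLp f 2 (volume.restrict (Set.Ioc 0 Real.pi)) := by
  rw [memLp_two_iff_integrable_sq hf.aestronglyMeasurable]
  exact ((hf.pow 2).integrableOn_Icc).mono_set Set.Ioc_subset_Icc_self

lemma integral_log_sin_mul_cos (j : ℕ) :
    ∫ x in (0 : ℝ)..Real.pi, Real.log (2 * Real.sin x) * Real.cos (2 * (j + 1) * x)
      = -(Real.pi / (2 * (j + 1))) := by
  have h0 : ∀ k ∉ ({j} : Finset ℕ), 1 / ((k : ℝ) + 1) * (∫ x in (0 : ℝ)..Real.pi,
      Real.cos (2 * (j + 1) * x) * Real.cos (2 * (k + 1) * x)) = 0 := by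
    intro k hk
    rw [integral_cos_mul_cos, if_neg (by simpa using hk), mul_zero]
  have h1 := hasSum_sum_of_ne_finset_zero (L := .unconditional ℕ) h0
  have h2 := hasSum_integral_mul_cos_of_summable
    (memLp_two_of_continuous (f := fun x => Real.cos (2 * (j + 1) * x)) (by fun_prop)) h1.summable
  have h3 := h1.unique h2
  rw [Finset.sum_singleton, integral_cos_mul_cos, if_pos rfl] at h3
  simp_rw [mul_comm (Real.log _)]
  rw [eq_comm, neg_eq_iff_eq_neg, ← h3]
  field_simp

lemma integral_log_sin_mul_sin (j : ℕ) :
    ∫ x in (0 : ℝ)..Real.pi, Real.log (2 * Real.sin x) * Real.sin (2 * (j + 1) * x) = 0 := by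
  have h := intervalIntegral.integral_comp_sub_left
    (fun x => Real.log (2 * Real.sin x) * Real.sin (2 * (j + 1) * x)) Real.pi (a := 0)
    (b := Real.pi)
  have e : ∀ x : ℝ, Real.log (2 * Real.sin (Real.pi - x)) * Real.sin (2 * (j + 1) * (Real.pi - x))
      = -(Real.log (2 * Real.sin x) * Real.sin (2 * (j + 1) * x)) := by
    intro x
    have : 2 * ((j : ℝ) + 1) * (Real.pi - x) = (j + 1 : ℕ) * (2 * Real.pi) - 2 * (j + 1) * x := by
      push_cast; ring
    rw [Real.sin_pi_sub, this, Real.sin_nat_mul_two_pi_sub]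
    ring
  simp_rw [e] at h
  rw [intervalIntegral.integral_neg, sub_self, sub_zero] at h
  linarith

lemma periodic_log_sin : Function.Periodic (fun x => Real.log (2 * Real.sin x)) Real.pi := by
  intro x
  simp only
  rw [Real.sin_add_pi, mul_neg, Real.log_neg_eq_log]

lemma memLp_log_two_mul_sin : MemLp (fun x => Real.log (2 * Real.sin x)) 2
    (volume.restrict (Set.Ioc 0 Real.pi)) := by
  refine ((memLp_const (Real.log 2)).add memLp_log_sin).ae_eq ?_
  filter_upwards [ae_sin_ne_zero] with x hx
  rw [Real.log_mul two_ne_zero hx]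
  rfl

lemma memLp_log_two_mul_sin_sub (a : ℝ) : MemLp (fun x => Real.log (2 * Real.sin (x - a))) 2
    (volume.restrict (Set.Ioc 0 Real.pi)) := by
  have hm : Measurable (fun x => Real.log (2 * Real.sin (x - a))) := by fun_prop
  rw [memLp_two_iff_integrable_sq hm.aestronglyMeasurable]
  have h1 := (memLp_two_iff_integrable_sq memLp_log_two_mul_sin.1).1 memLp_log_two_mul_sin
  have h2 : IntervalIntegrable (fun x => Real.log (2 * Real.sin x) ^ 2) volume 0 Real.pi :=
    (intervalIntegrable_iff_integrableOn_Ioc_of_le Real.pi_pos.le).2 h1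
  have hper : Function.Periodic (fun x => Real.log (2 * Real.sin x) ^ 2) Real.pi := by
    intro x
    have := periodic_log_sin x
    simp only at this ⊢
    rw [this]
  have h3 := hper.intervalIntegrable₀ Real.pi_ne_zero h2 (-a) (Real.pi - a)
  have h4 := h3.comp_sub_right a
  simp only [neg_add_cancel, sub_add_cancel] at h4
  exact (intervalIntegrable_iff_integrableOn_Ioc_of_le Real.pi_pos.le).1 h4

lemma integral_log_sin_sub_mul_cos (a : ℝ) (j : ℕ) :
    ∫ x in (0 : ℝ)..Real.pi, Real.log (2 * Real.sin (x - a)) * Real.cos (2 * (j + 1) * x)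
      = -(Real.pi / (2 * (j + 1))) * Real.cos (2 * (j + 1) * a) := by
  have h := intervalIntegral.integral_comp_sub_right
    (fun x => Real.log (2 * Real.sin x) * Real.cos (2 * (j + 1) * (x + a))) a (a := 0)
    (b := Real.pi)
  simp only [sub_add_cancel] at h
  rw [h]
  have hper : Function.Periodic
      (fun x => Real.log (2 * Real.sin x) * Real.cos (2 * (j + 1) * (x + a))) Real.pi := by
    intro x
    have := periodic_log_sin x
    simp only at this ⊢
    have e : 2 * ((j : ℝ) + 1) * (x + Real.pi + a)
        = 2 * (j + 1) * (x + a) + (j + 1 : ℕ) * (2 * Real.pi) := by push_cast; ring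
    rw [this, e, Real.cos_add_nat_mul_two_pi]
  have h2 := hper.intervalIntegral_add_eq (0 - a) 0
  rw [show 0 - a + Real.pi = Real.pi - a by ring, zero_add] at h2
  rw [h2]
  have e : ∀ x : ℝ, Real.log (2 * Real.sin x) * Real.cos (2 * (j + 1) * (x + a))
      = Real.log (2 * Real.sin x) * Real.cos (2 * (j + 1) * x) * Real.cos (2 * (j + 1) * a)
        - Real.log (2 * Real.sin x) * Real.sin (2 * (j + 1) * x) * Real.sin (2 * (j + 1) * a) := by
    intro x
    rw [mul_add, Real.cos_add]; ring
  have hl : IntervalIntegrable (fun x => Real.log (2 * Real.sin x)) volume 0 Real.pi :=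
    (intervalIntegrable_iff_integrableOn_Ioc_of_le Real.pi_pos.le).2
      (memLp_log_two_mul_sin.integrable (by norm_num))
  simp_rw [e]
  rw [intervalIntegral.integral_sub, intervalIntegral.integral_mul_const,
    intervalIntegral.integral_mul_const, integral_log_sin_mul_cos, integral_log_sin_mul_sin]
  · ring
  · exact (hl.mul_continuousOn (by fun_prop)).mul_const _
  · exact (hl.mul_continuousOn (by fun_prop)).mul_const _

/-- The autocorrelation of `log |2 sin x|` over a period. -/
lemma integral_log_sin_sub_mul_log_sin {a : ℝ} (h0 : 0 ≤ a) (h1 : a ≤ Real.pi) :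
    ∫ x in (0 : ℝ)..Real.pi, Real.log (2 * Real.sin (x - a)) * Real.log (2 * Real.sin x)
      = Real.pi / 2 * (a ^ 2 - Real.pi * a + Real.pi ^ 2 / 6) := by
  have hpi := Real.pi_pos
  have hB := hasSum_one_div_nat_pow_mul_cos one_ne_zero (x := a / Real.pi)
    ⟨by positivity, by rw [div_le_one hpi]; exact h1⟩
  rw [← hasSum_nat_add_iff' 1] at hB
  have hv : (-1 : ℝ) ^ (1 + 1) * (2 * Real.pi) ^ (2 * 1) / 2 / (2 * 1).factorial *
      (Polynomial.map (algebraMap ℚ ℝ) (Polynomial.bernoulli (2 * 1))).eval (a / Real.pi)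
      - ∑ i ∈ Finset.range 1, 1 / (i : ℝ) ^ (2 * 1) * Real.cos (2 * Real.pi * i * (a / Real.pi))
      = a ^ 2 - Real.pi * a + Real.pi ^ 2 / 6 := by
    rw [Polynomial.bernoulli]
    simp [Finset.sum_range_succ, bernoulli_eq_bernoulli'_of_ne_one, Polynomial.eval_add]
    field_simp
    ring
  rw [hv] at hB
  have hS : HasSum (fun k : ℕ => 1 / ((k : ℝ) + 1) *
      ∫ x in (0 : ℝ)..Real.pi, Real.log (2 * Real.sin (x - a)) * Real.cos (2 * (k + 1) * x))
      (-(Real.pi / 2) * (a ^ 2 - Real.pi * a + Real.pi ^ 2 / 6)) := by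
    refine (hB.mul_left (-(Real.pi / 2))).congr_fun fun k => ?_
    rw [integral_log_sin_sub_mul_cos]
    have : 2 * Real.pi * ((k + 1 : ℕ) : ℝ) * (a / Real.pi) = 2 * (k + 1) * a := by
      push_cast; field_simp
    rw [this]
    push_cast
    field_simp
  have h2 := hS.unique (hasSum_integral_mul_cos_of_summable (memLp_log_two_mul_sin_sub a) hS.summable)
  linarith

lemma hasSum_one_div_cube : HasSum (fun n : ℕ => 1 / (n : ℝ) ^ 3) (riemannZeta 3).re := by
  have h := zeta_nat_eq_tsum_of_gt_one (k := 3) (by norm_num)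
  have hs : Summable (fun n : ℕ => 1 / (n : ℝ) ^ 3) := Real.summable_one_div_nat_pow.2 (by norm_num)
  have e : (riemannZeta 3) = ((∑' n : ℕ, 1 / (n : ℝ) ^ 3 : ℝ) : ℂ) := by
    push_cast at h ⊢
    exact h
  rw [e, Complex.ofReal_re]
  exact hs.hasSum

lemma hasSum_one_sub_neg_one_pow_div_cube :
    HasSum (fun k : ℕ => (1 - (-1 : ℝ) ^ (k + 1)) / ((k : ℝ) + 1) ^ 3)
      (7 / 4 * (riemannZeta 3).re) := by
  have h := hasSum_one_div_cube
  have he : HasSum (fun n : ℕ => 1 / ((2 * n : ℕ) : ℝ) ^ 3) ((riemannZeta 3).re / 8) := by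
    refine (h.div_const 8).congr_fun fun n => ?_
    push_cast
    rw [mul_pow, div_div, mul_comm]
    norm_num
  have hos : Summable (fun n : ℕ => 1 / ((2 * n + 1 : ℕ) : ℝ) ^ 3) :=
    h.summable.comp_injective (i := fun n : ℕ => 2 * n + 1) (fun a b hab => by simpa using hab)
  have ho : HasSum (fun n : ℕ => 1 / ((2 * n + 1 : ℕ) : ℝ) ^ 3) (7 / 8 * (riemannZeta 3).re) := by
    have h2 := HasSum.even_add_odd (f := fun n : ℕ => 1 / (n : ℝ) ^ 3) he hos.hasSum
    have := h2.unique h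
    have e : 7 / 8 * (riemannZeta 3).re = ∑' n : ℕ, 1 / ((2 * n + 1 : ℕ) : ℝ) ^ 3 := by linarith
    rw [e]
    exact hos.hasSum
  have h3 : HasSum (fun k : ℕ => (1 - (-1 : ℝ) ^ k) / (k : ℝ) ^ 3)
      (0 + 2 * (7 / 8 * (riemannZeta 3).re)) := by
    refine HasSum.even_add_odd (f := fun k : ℕ => (1 - (-1 : ℝ) ^ k) / (k : ℝ) ^ 3) ?_ ?_
    · simp
    · refine (ho.mul_left 2).congr_fun fun n => ?_
      rw [pow_succ, pow_mul]
      norm_num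
      ring
  rw [← hasSum_nat_add_iff' 1] at h3
  simp only [Finset.range_one, Finset.sum_singleton] at h3
  convert! h3 using 1
  · simp
  · norm_num; ring

lemma integral_mul_cos_zero_pi_div_two (k : ℕ) :
    ∫ x in (0 : ℝ)..Real.pi / 2, x * Real.cos (2 * (k + 1) * x)
      = ((-1) ^ (k + 1) - 1) / (4 * ((k : ℝ) + 1) ^ 2) := by
  have hk : (2 * ((k : ℝ) + 1)) ≠ 0 := by positivity
  have h : ∀ x ∈ Set.uIcc 0 (Real.pi / 2), HasDerivAt (fun x : ℝ =>
      x * Real.sin (2 * (k + 1) * x) / (2 * (k + 1))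
        + Real.cos (2 * (k + 1) * x) / (4 * ((k : ℝ) + 1) ^ 2))
      (x * Real.cos (2 * (k + 1) * x)) x := by
    intro x _
    have h1 : HasDerivAt (fun x : ℝ => 2 * ((k : ℝ) + 1) * x) (2 * (k + 1)) x := by
      simpa using (hasDerivAt_id x).const_mul (2 * ((k : ℝ) + 1))
    have h2 := (((hasDerivAt_id x).mul h1.sin).div_const (2 * ((k : ℝ) + 1))).add
      (h1.cos.div_const (4 * ((k : ℝ) + 1) ^ 2))
    convert! h2 using 1
    simp
    field_simp
    ring
  rw [intervalIntegral.integral_eq_sub_of_hasDerivAt h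
    (Continuous.intervalIntegrable (by fun_prop) _ _)]
  have e : 2 * ((k : ℝ) + 1) * (Real.pi / 2) = (k + 1 : ℕ) * Real.pi := by push_cast; ring
  rw [e, Real.sin_nat_mul_pi, Real.cos_nat_mul_pi]
  simp
  field_simp

lemma intervalIntegrable_log_two_mul_sin :
    IntervalIntegrable (fun x => Real.log (2 * Real.sin x)) volume 0 Real.pi :=
  (intervalIntegrable_iff_integrableOn_Ioc_of_le Real.pi_pos.le).2
    (memLp_log_two_mul_sin.integrable (by norm_num))

lemma integral_mul_log_two_mul_sin :
    ∫ x in (0 : ℝ)..Real.pi / 2, x * Real.log (2 * Real.sin x)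
      = 7 / 16 * (riemannZeta 3).re := by
  have hpi := Real.pi_pos
  set f : ℝ → ℝ := (Set.Ioc 0 (Real.pi / 2)).indicator (fun x => x) with hf
  have hfm : MemLp f 2 (volume.restrict (Set.Ioc 0 Real.pi)) :=
    (memLp_two_of_continuous continuous_id).indicator measurableSet_Ioc
  have hred : ∀ g : ℝ → ℝ, ∫ x in (0 : ℝ)..Real.pi, f x * g x
      = ∫ x in (0 : ℝ)..Real.pi / 2, x * g x := by
    intro g
    rw [intervalIntegral.integral_of_le hpi.le, intervalIntegral.integral_of_le (by positivity)]
    have : (fun x => f x * g x) = (Set.Ioc 0 (Real.pi / 2)).indicator (fun x => x * g x) := by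
      ext x
      simp only [hf, Set.indicator]
      split_ifs <;> simp
    rw [this, setIntegral_indicator measurableSet_Ioc, Set.inter_eq_self_of_subset_right]
    exact Set.Ioc_subset_Ioc_right (by linarith)
  have hS : HasSum (fun k : ℕ => 1 / ((k : ℝ) + 1) *
      ∫ x in (0 : ℝ)..Real.pi, f x * Real.cos (2 * (k + 1) * x))
      (-(1 / 4) * (7 / 4 * (riemannZeta 3).re)) := by
    refine (hasSum_one_sub_neg_one_pow_div_cube.mul_left (-(1 / 4))).congr_fun fun k => ?_
    rw [hred, integral_mul_cos_zero_pi_div_two]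
    field_simp
    ring
  have h := hS.unique (hasSum_integral_mul_cos_of_summable hfm hS.summable)
  rw [hred] at h
  linarith

lemma integral_mul_log_sin :
    ∫ x in (0 : ℝ)..Real.pi / 2, x * Real.log (Real.sin x)
      = 7 / 16 * (riemannZeta 3).re - Real.pi ^ 2 / 8 * Real.log 2 := by
  have hpi := Real.pi_pos
  rw [← integral_mul_log_two_mul_sin]
  have h1 : IntervalIntegrable (fun x => x * Real.log (2 * Real.sin x)) volume 0 (Real.pi / 2) := by
    refine (intervalIntegrable_log_two_mul_sin.mono_set ?_).continuousOn_mul (by fun_prop)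
    rw [Set.uIcc_of_le hpi.le, Set.uIcc_of_le (by positivity)]
    exact Set.Icc_subset_Icc_right (by linarith)
  have h2 : ∫ x in (0 : ℝ)..Real.pi / 2, x * Real.log (Real.sin x)
      = ∫ x in (0 : ℝ)..Real.pi / 2, (x * Real.log (2 * Real.sin x) - x * Real.log 2) := by
    rw [intervalIntegral.integral_of_le (by positivity),
      intervalIntegral.integral_of_le (by positivity)]
    refine setIntegral_congr_fun measurableSet_Ioc fun x hx => ?_
    have : Real.sin x ≠ 0 := (Real.sin_pos_of_pos_of_lt_pi hx.1 (by linarith [hx.2])).ne'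
    rw [Real.log_mul two_ne_zero this]
    ring
  rw [h2, intervalIntegral.integral_sub h1 (Continuous.intervalIntegrable (by fun_prop) _ _),
    intervalIntegral.integral_mul_const, integral_id]
  ring

lemma integrableOn_sq_mul_cot :
    IntegrableOn (fun x => x ^ 2 * (Real.cos x / Real.sin x)) (Set.Ioc 0 (Real.pi / 2)) := by
  have hpi := Real.pi_pos
  refine Measure.integrableOn_of_bounded (M := (Real.pi / 2) ^ 2) (by simp)
    (Measurable.aestronglyMeasurable (by fun_prop)) ?_
  filter_upwards [ae_restrict_mem measurableSet_Ioc] with x hx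
  have hs := Real.mul_le_sin hx.1.le hx.2
  have hs0 := Real.sin_pos_of_pos_of_lt_pi hx.1 (by linarith [hx.2])
  have hc0 := Real.cos_nonneg_of_mem_Icc ⟨by linarith [hx.1], hx.2⟩
  have hx0 := hx.1
  rw [Real.norm_of_nonneg (by positivity), mul_div_assoc', div_le_iff₀ hs0]
  have h1 : x ≤ Real.pi / 2 * Real.sin x := by
    calc x = Real.pi / 2 * (2 / Real.pi * x) := by field_simp
      _ ≤ _ := by gcongr
  calc x ^ 2 * Real.cos x ≤ x ^ 2 * 1 := by gcongr; exact Real.cos_le_one x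
    _ = x * x := by ring
    _ ≤ Real.pi / 2 * (Real.pi / 2 * Real.sin x) := by gcongr; exact hx.2
    _ = _ := by ring

lemma integral_sq_mul_cot :
    ∫ x in (0 : ℝ)..Real.pi / 2, x ^ 2 * (Real.cos x / Real.sin x)
      = Real.pi ^ 2 * Real.log 2 / 4 - 7 * (riemannZeta 3).re / 8 := by
  have hpi := Real.pi_pos
  have hi1 : IntervalIntegrable (fun x => x ^ 2 * (Real.cos x / Real.sin x)) volume 0
      (Real.pi / 2) :=
    (intervalIntegrable_iff_integrableOn_Ioc_of_le (by positivity)).2 integrableOn_sq_mul_cot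
  have hi2 : IntervalIntegrable (fun x => 2 * (x * Real.log (Real.sin x))) volume 0
      (Real.pi / 2) := by
    refine (IntervalIntegrable.continuousOn_mul ?_ (by fun_prop)).const_mul 2
    have : IntervalIntegrable (fun x => Real.log (Real.sin x)) volume 0 Real.pi :=
      (intervalIntegrable_iff_integrableOn_Ioc_of_le hpi.le).2 (memLp_log_sin.integrable (by norm_num))
    refine this.mono_set ?_
    rw [Set.uIcc_of_le hpi.le, Set.uIcc_of_le (by positivity)]
    exact Set.Icc_subset_Icc_right (by linarith)
  have hsin : ∀ x ∈ Set.Ioo 0 (Real.pi / 2), 0 < Real.sin x := fun x hx =>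
    Real.sin_pos_of_pos_of_lt_pi hx.1 (by linarith [hx.2])
  have key : ∫ x in (0 : ℝ)..Real.pi / 2,
      (2 * (x * Real.log (Real.sin x)) + x ^ 2 * (Real.cos x / Real.sin x)) = 0 - 0 := by
    refine intervalIntegral.integral_eq_sub_of_hasDerivAt_of_tendsto (by positivity)
      (f := fun x => x ^ 2 * Real.log (Real.sin x)) ?_ (hi2.add hi1) ?_ ?_
    · intro x hx
      have h1 := (hasDerivAt_pow 2 x).mul ((Real.hasDerivAt_sin x).log (hsin x hx).ne')
      convert! h1 using 1
      push_cast
      ring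
    · have h1 : Tendsto (fun x => Real.log (Real.sin x) * Real.sin x) (𝓝[>] 0) (𝓝 0) := by
        have : Tendsto (fun y : ℝ => Real.log y * y) (𝓝 0) (𝓝 0) := by
          have := Real.continuous_mul_log.tendsto 0
          simpa [mul_comm] using this
        have hs : Tendsto Real.sin (𝓝[>] 0) (𝓝 0) := by
          simpa using (Real.continuous_sin.tendsto 0).mono_left nhdsWithin_le_nhds
        exact this.comp hs
      have hb : ∀ᶠ x in 𝓝[>] (0 : ℝ), ‖x ^ 2 * Real.log (Real.sin x)‖
          ≤ (Real.pi / 2) ^ 2 * ‖Real.log (Real.sin x) * Real.sin x‖ := by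
        filter_upwards [Ioo_mem_nhdsGT (show (0 : ℝ) < Real.pi / 2 by positivity)] with x hx
        have hs0 := hsin x hx
        have hs := Real.mul_le_sin hx.1.le hx.2.le
        have hx0 := hx.1
        rw [norm_mul, norm_mul, Real.norm_of_nonneg hs0.le, Real.norm_of_nonneg (by positivity)]
        have h2 : x ≤ Real.pi / 2 * Real.sin x := by
          calc x = Real.pi / 2 * (2 / Real.pi * x) := by field_simp
            _ ≤ _ := by gcongr
        have h3 : x ^ 2 ≤ (Real.pi / 2) ^ 2 * Real.sin x := by
          calc x ^ 2 = x * x := by ring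
            _ ≤ Real.pi / 2 * (Real.pi / 2 * Real.sin x) := by gcongr; exact hx.2.le
            _ = _ := by ring
        calc _ ≤ (Real.pi / 2) ^ 2 * Real.sin x * ‖Real.log (Real.sin x)‖ := by gcongr
          _ = _ := by ring
      refine squeeze_zero_norm' hb ?_
      have := (h1.norm).const_mul ((Real.pi / 2) ^ 2)
      simpa using this
    · have hc : ContinuousAt (fun x => x ^ 2 * Real.log (Real.sin x)) (Real.pi / 2) := by
        refine ContinuousAt.mul (by fun_prop) (ContinuousAt.log (by fun_prop) (by simp))
      have := hc.tendsto.mono_left (nhdsWithin_le_nhds (s := Set.Iio (Real.pi / 2)))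
      simpa using this
  rw [intervalIntegral.integral_add hi2 hi1, intervalIntegral.integral_const_mul,
    integral_mul_log_sin] at key
  linarith

lemma arcsinSqCoeff_le (j : ℕ) : arcsinSqCoeff j ≤ 1 / ((j : ℝ) + 1) := by
  have h := arcsinSqCoeff_mul_le j
  have : 0 < 2 * (j : ℝ) + 1 := by positivity
  rw [le_div_iff₀ (by positivity)]
  refine le_of_mul_le_mul_right ?_ this
  linarith

lemma summable_arcsinSqCoeff_div : Summable (fun j : ℕ => arcsinSqCoeff j / (2 * (j + 1))) := by
  have h1 : Summable (fun j : ℕ => 1 / ((j : ℝ) + 1) ^ 2) := by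
    have := (summable_nat_add_iff 1).2 (Real.summable_one_div_nat_pow.2 (one_lt_two))
    simpa using this
  refine h1.of_nonneg_of_le (fun j => by have := arcsinSqCoeff_pos j; positivity) fun j => ?_
  calc arcsinSqCoeff j / (2 * (j + 1)) ≤ (1 / ((j : ℝ) + 1)) / (1 * (j + 1)) := by
        gcongr
        · exact arcsinSqCoeff_le j
        · norm_num
    _ = _ := by field_simp

lemma hasSum_arcsinSqCoeff_div :
    HasSum (fun j : ℕ => arcsinSqCoeff j / (2 * (j + 1)))
      (Real.pi ^ 2 * Real.log 2 / 4 - 7 * (riemannZeta 3).re / 8) := by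
  have hpi := Real.pi_pos
  rw [← integral_sq_mul_cot, intervalIntegral.integral_of_le (by positivity)]
  have hI : ∀ j : ℕ, ∫ x in Set.Ioc 0 (Real.pi / 2),
      arcsinSqCoeff j * Real.sin x ^ (2 * j + 1) * Real.cos x = arcsinSqCoeff j / (2 * (j + 1)) := by
    intro j
    rw [← intervalIntegral.integral_of_le (by positivity),
      intervalIntegral.integral_eq_sub_of_hasDerivAt
      (f := fun x => arcsinSqCoeff j * Real.sin x ^ (2 * j + 2) / (2 * (j + 1))) ?_
      (Continuous.intervalIntegrable (by fun_prop) _ _)]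
    · simp
    · intro x _
      have := (((Real.hasDerivAt_sin x).pow (2 * j + 2)).const_mul (arcsinSqCoeff j)).div_const
        (2 * ((j : ℝ) + 1))
      convert! this using 1
      push_cast
      field_simp
  have hint : ∀ j : ℕ, IntegrableOn (fun x => arcsinSqCoeff j * Real.sin x ^ (2 * j + 1) * Real.cos x)
      (Set.Ioc 0 (Real.pi / 2)) := fun j =>
    (Continuous.integrableOn_Icc (by fun_prop)).mono_set Set.Ioc_subset_Icc_self
  have hnorm : ∀ j : ℕ, ∫ x in Set.Ioc 0 (Real.pi / 2),
      ‖arcsinSqCoeff j * Real.sin x ^ (2 * j + 1) * Real.cos x‖ = arcsinSqCoeff j / (2 * (j + 1)) := by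
    intro j
    rw [← hI]
    refine setIntegral_congr_fun measurableSet_Ioc fun x hx => ?_
    have h1 := Real.sin_nonneg_of_nonneg_of_le_pi hx.1.le (by linarith [hx.2])
    have h2 := Real.cos_nonneg_of_mem_Icc ⟨by linarith [hx.1], hx.2⟩
    have h3 := arcsinSqCoeff_pos j
    exact Real.norm_of_nonneg (by positivity)
  have h := hasSum_integral_of_summable_integral_norm hint
    (by simp_rw [hnorm]; exact summable_arcsinSqCoeff_div)
  simp_rw [hI] at h
  convert! h using 1
  rw [Measure.restrict_congr_set Ioo_ae_eq_Ioc.symm]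
  refine setIntegral_congr_fun measurableSet_Ioo fun x hx => ?_
  have hs0 : Real.sin x ≠ 0 := (Real.sin_pos_of_pos_of_lt_pi hx.1 (by linarith [hx.2])).ne'
  have := (hasSum_arcsinSqCoeff_mul_sin hx.1.le hx.2).mul_right (Real.cos x / Real.sin x)
  rw [← this.tsum_eq]
  refine tsum_congr fun j => ?_
  field_simp
  ring

lemma sq_log_le_rpow_add {x : ℝ} (hx : 0 < x) :
    Real.log x ^ 2 ≤ 16 * x ^ (-(1 / 2) : ℝ) + x ^ (2 : ℝ) := by
  have p1 := Real.rpow_nonneg hx.le (-(1 / 2) : ℝ)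
  have p2 := Real.rpow_nonneg hx.le 2
  rcases le_total x 1 with h | h
  · linarith [sq_log_le hx h]
  · have h1 := Real.log_nonneg h
    have h2 : Real.log x ≤ x := (Real.log_le_sub_one_of_pos hx).trans (by linarith)
    have : Real.log x ^ 2 ≤ x ^ 2 := by gcongr
    rw [Real.rpow_two]
    linarith

lemma integrableOn_sq_log_mul_exp :
    IntegrableOn (fun x : ℝ => Real.log x ^ 2 * Real.exp (-(1 / 2) * x ^ 2)) (Set.Ioi 0) := by
  have h1 := (integrableOn_rpow_mul_exp_neg_mul_sq (b := 1 / 2) (by norm_num)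
    (s := -(1 / 2)) (by norm_num)).const_mul 16
  have h2 := integrableOn_rpow_mul_exp_neg_mul_sq (b := 1 / 2) (by norm_num)
    (s := 2) (by norm_num)
  refine Integrable.mono' (h1.add h2) (Measurable.aestronglyMeasurable (by fun_prop)) ?_
  filter_upwards [ae_restrict_mem measurableSet_Ioi] with x hx
  have := sq_log_le_rpow_add hx
  rw [Real.norm_of_nonneg (by positivity)]
  calc _ ≤ (16 * x ^ (-(1 / 2) : ℝ) + x ^ (2 : ℝ)) * Real.exp (-(1 / 2) * x ^ 2) := by gcongr
    _ = _ := by simp only [Pi.add_apply]; ring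

lemma integrableOn_mul_exp_mul_sq_log :
    IntegrableOn (fun r : ℝ => r * Real.exp (-(1 / 2) * r ^ 2) * Real.log (r / 2) ^ 2)
      (Set.Ioi 0) := by
  have h1 := (integrableOn_rpow_mul_exp_neg_mul_sq (b := 1 / 2) (by norm_num)
    (s := 1 / 2) (by norm_num)).const_mul 32
  have h2 := integrableOn_rpow_mul_exp_neg_mul_sq (b := 1 / 2) (by norm_num)
    (s := 3) (by norm_num)
  refine Integrable.mono' (h1.add h2) (Measurable.aestronglyMeasurable (by fun_prop)) ?_
  filter_upwards [ae_restrict_mem measurableSet_Ioi] with r hr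
  have hr0 : (0 : ℝ) < r := hr
  have := sq_log_le_rpow_add (x := r / 2) (by positivity)
  rw [Real.norm_of_nonneg (by positivity)]
  have e1 : r * (r / 2) ^ (-(1 / 2) : ℝ) ≤ 2 * r ^ (1 / 2 : ℝ) := by
    rw [Real.div_rpow hr0.le (by norm_num), Real.rpow_neg (by norm_num : (0 : ℝ) ≤ 2),
      div_inv_eq_mul, ← mul_assoc]
    have : r * r ^ (-(1 / 2) : ℝ) = r ^ (1 / 2 : ℝ) := by
      rw [← Real.rpow_one_add' hr0.le (by norm_num)]; norm_num
    rw [this, mul_comm]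
    gcongr
    calc (2 : ℝ) ^ (1 / 2 : ℝ) ≤ 2 ^ (1 : ℝ) :=
          Real.rpow_le_rpow_of_exponent_le (by norm_num) (by norm_num)
      _ = 2 := Real.rpow_one 2
  have e2 : r * (r / 2) ^ (2 : ℝ) ≤ r ^ (3 : ℝ) := by
    rw [Real.rpow_two, show (3 : ℝ) = ((3 : ℕ) : ℝ) by norm_num, Real.rpow_natCast]
    have : 0 < r ^ 3 := by positivity
    nlinarith
  calc r * Real.exp (-(1 / 2) * r ^ 2) * Real.log (r / 2) ^ 2
      ≤ r * Real.exp (-(1 / 2) * r ^ 2) * (16 * (r / 2) ^ (-(1 / 2) : ℝ) + (r / 2) ^ (2 : ℝ)) := by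
        gcongr
    _ = (16 * (r * (r / 2) ^ (-(1 / 2) : ℝ)) + r * (r / 2) ^ (2 : ℝ))
        * Real.exp (-(1 / 2) * r ^ 2) := by ring
    _ ≤ (16 * (2 * r ^ (1 / 2 : ℝ)) + r ^ (3 : ℝ)) * Real.exp (-(1 / 2) * r ^ 2) := by gcongr
    _ = _ := by simp only [Pi.add_apply]; ring

lemma integrable_of_even_of_integrableOn_Ioi {f : ℝ → ℝ} (he : ∀ x, f (-x) = f x)
    (hf : IntegrableOn f (Set.Ioi 0)) : Integrable f := by
  have h2 : IntegrableOn f (Set.Iio 0) := by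
    have := IntegrableOn.comp_neg_Iio (c := (0 : ℝ)) (f := f) (by rwa [neg_zero])
    simpa only [he] using this
  rw [← integrableOn_univ, ← Set.Iic_union_Ioi (a := (0 : ℝ))]
  exact ((integrableOn_Iic_iff_integrableOn_Iio (by simp)).2 h2).union hf

lemma gaussianPDFReal_zero_one (x : ℝ) :
    gaussianPDFReal 0 1 x = (√(2 * Real.pi))⁻¹ * Real.exp (-(1 / 2) * x ^ 2) := by
  rw [gaussianPDFReal]
  simp
  left
  ring

lemma memLp_log_gaussianReal : MemLp Real.log 2 (gaussianReal 0 1) := by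
  rw [memLp_two_iff_integrable_sq Real.measurable_log.aestronglyMeasurable,
    gaussianReal_of_var_ne_zero 0 one_ne_zero,
    integrable_withDensity_iff (measurable_gaussianPDF 0 1) (ae_of_all _ fun _ => gaussianPDF_lt_top)]
  have h := integrable_of_even_of_integrableOn_Ioi
    (f := fun x : ℝ => Real.log x ^ 2 * Real.exp (-(1 / 2) * x ^ 2)) (by intro x; simp)
    integrableOn_sq_log_mul_exp
  refine (h.const_mul (√(2 * Real.pi))⁻¹).congr (ae_of_all _ fun x => ?_)
  simp only
  rw [toReal_gaussianPDF, gaussianPDFReal_zero_one]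
  ring

lemma integral_Ioi_mul_exp : ∫ r in Set.Ioi (0 : ℝ), r * Real.exp (-(1 / 2) * r ^ 2) = 1 := by
  have h := integral_Ioi_of_hasDerivAt_of_tendsto' (a := (0 : ℝ))
    (f := fun r => -Real.exp (-(1 / 2) * r ^ 2)) (f' := fun r => r * Real.exp (-(1 / 2) * r ^ 2))
    (m := 0) (fun x _ => ?_) ?_ ?_
  · simpa using h
  · have := (((hasDerivAt_pow 2 x).const_mul (-(1 / 2) : ℝ)).exp).neg
    convert! this using 1
    push_cast
    ring
  · exact (integrable_mul_exp_neg_mul_sq (by norm_num)).integrableOn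
  · have : Tendsto (fun r : ℝ => -(1 / 2) * r ^ 2) atTop atBot :=
      (tendsto_pow_atTop two_ne_zero).const_mul_atTop_of_neg (by norm_num)
    simpa using (Real.tendsto_exp_atBot.comp this).neg

lemma periodic_log_two_mul_cos_sub (a : ℝ) :
    Function.Periodic (fun x => Real.log (2 * Real.cos (x - a))) Real.pi := by
  intro x
  simp only
  rw [show x + Real.pi - a = (x - a) + Real.pi by ring, Real.cos_add_pi, mul_neg,
    Real.log_neg_eq_log]

lemma memLp_log_two_mul_cos_sub (a : ℝ) : MemLp (fun x => Real.log (2 * Real.cos (x - a))) 2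
    (volume.restrict (Set.Ioo (-Real.pi) Real.pi)) := by
  have hpi := Real.pi_pos
  have hm : Measurable (fun x => Real.log (2 * Real.cos (x - a))) := by fun_prop
  rw [memLp_two_iff_integrable_sq hm.aestronglyMeasurable]
  have h1 := (memLp_two_iff_integrable_sq hm.aestronglyMeasurable).1
    ((memLp_log_two_mul_sin_sub (a - Real.pi / 2)).ae_eq (ae_of_all _ fun x => by
      rw [show x - (a - Real.pi / 2) = (x - a) + Real.pi / 2 by ring, Real.sin_add_pi_div_two]))
  have h2 : IntervalIntegrable (fun x => Real.log (2 * Real.cos (x - a)) ^ 2) volume 0 Real.pi :=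
    (intervalIntegrable_iff_integrableOn_Ioc_of_le hpi.le).2 h1
  have hper : Function.Periodic (fun x => Real.log (2 * Real.cos (x - a)) ^ 2) Real.pi := by
    intro x
    have := periodic_log_two_mul_cos_sub a x
    simp only at this ⊢
    rw [this]
  have h3 := hper.intervalIntegrable₀ Real.pi_ne_zero h2 (-Real.pi) Real.pi
  exact ((intervalIntegrable_iff_integrableOn_Ioc_of_le (by linarith)).1 h3).mono_set
    Set.Ioo_subset_Ioc_self

lemma integral_Ioo_eq_two_mul_of_periodic {f : ℝ → ℝ} (hf : Function.Periodic f Real.pi)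
    (hi : IntegrableOn f (Set.Ioo (-Real.pi) Real.pi)) (s : ℝ) :
    ∫ x in Set.Ioo (-Real.pi) Real.pi, f x = 2 * ∫ x in s..s + Real.pi, f x := by
  have hpi := Real.pi_pos
  have h1 : IntervalIntegrable f volume (-Real.pi) Real.pi :=
    (intervalIntegrable_iff_integrableOn_Ioo_of_le (by linarith)).2 hi
  have h2 := hf.intervalIntegral_add_eq (-Real.pi) s
  have h3 := hf.intervalIntegral_add_eq 0 s
  rw [neg_add_cancel] at h2
  rw [zero_add] at h3
  rw [← integral_Ioc_eq_integral_Ioo, ← intervalIntegral.integral_of_le (by linarith),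
    ← intervalIntegral.integral_add_adjacent_intervals (b := 0), h2, h3]
  · ring
  · refine h1.mono_set (Set.uIcc_subset_uIcc (by simp) ?_)
    rw [Set.mem_uIcc]; left; constructor <;> linarith
  · refine h1.mono_set (Set.uIcc_subset_uIcc ?_ (by simp))
    rw [Set.mem_uIcc]; left; constructor <;> linarith

lemma integral_log_two_mul_cos_sub (a : ℝ) :
    ∫ x in Set.Ioo (-Real.pi) Real.pi, Real.log (2 * Real.cos (x - a))
      = ∫ x in Set.Ioo (-Real.pi) Real.pi, Real.log (2 * Real.cos x) := by
  have h0 := memLp_log_two_mul_cos_sub 0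
  have p0 := periodic_log_two_mul_cos_sub 0
  simp only [sub_zero] at h0 p0
  rw [integral_Ioo_eq_two_mul_of_periodic (periodic_log_two_mul_cos_sub a)
    ((memLp_log_two_mul_cos_sub a).integrable (by norm_num)) a,
    integral_Ioo_eq_two_mul_of_periodic p0 (h0.integrable (by norm_num)) 0,
    intervalIntegral.integral_comp_sub_right (fun x => Real.log (2 * Real.cos x))]
  simp

lemma integral_log_cos_mul_log_cos_sub {b : ℝ} (h0 : 0 ≤ b) (h1 : b ≤ Real.pi) :
    ∫ x in Set.Ioo (-Real.pi) Real.pi, Real.log (2 * Real.cos x) * Real.log (2 * Real.cos (x - b))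
      = Real.pi * (b ^ 2 - Real.pi * b + Real.pi ^ 2 / 6) := by
  have hm0 := memLp_log_two_mul_cos_sub 0
  have p0 := periodic_log_two_mul_cos_sub 0
  simp only [sub_zero] at hm0 p0
  have hp : Function.Periodic
      (fun x => Real.log (2 * Real.cos x) * Real.log (2 * Real.cos (x - b))) Real.pi :=
    p0.mul (periodic_log_two_mul_cos_sub b)
  rw [integral_Ioo_eq_two_mul_of_periodic hp (hm0.integrable_mul (memLp_log_two_mul_cos_sub b))
    (-(Real.pi / 2))]
  have h := intervalIntegral.integral_comp_sub_right
    (fun x => Real.log (2 * Real.cos x) * Real.log (2 * Real.cos (x - b))) (Real.pi / 2) (a := 0)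
    (b := Real.pi)
  rw [show -(Real.pi / 2) + Real.pi = Real.pi - Real.pi / 2 by ring,
    show -(Real.pi / 2) = 0 - Real.pi / 2 by ring, ← h]
  have := integral_log_sin_sub_mul_log_sin h0 h1
  simp_rw [show ∀ x, x - Real.pi / 2 - b = (x - b) - Real.pi / 2 by intro x; ring,
    Real.cos_sub_pi_div_two]
  simp_rw [mul_comm (Real.log (2 * Real.sin (_ - b)))] at this
  rw [this]
  ring

lemma integral_gaussian_prod_eq (f : ℝ × ℝ → ℝ) :
    ∫ p, f p ∂((gaussianReal 0 1).prod (gaussianReal 0 1))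
      = ∫ p, (2 * Real.pi)⁻¹ * Real.exp (-(1 / 2) * (p.1 ^ 2 + p.2 ^ 2)) * f p := by
  rw [gaussianReal_of_var_ne_zero 0 one_ne_zero,
    prod_withDensity (measurable_gaussianPDF 0 1) (measurable_gaussianPDF 0 1),
    integral_withDensity_eq_integral_toReal_smul (by fun_prop)
    (ae_of_all _ fun p => ENNReal.mul_lt_top gaussianPDF_lt_top gaussianPDF_lt_top)]
  rw [← Measure.volume_eq_prod]
  congr 1 with p
  rw [ENNReal.toReal_mul, toReal_gaussianPDF, toReal_gaussianPDF, gaussianPDFReal_zero_one,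
    gaussianPDFReal_zero_one, smul_eq_mul]
  have e : (√(2 * Real.pi))⁻¹ * (√(2 * Real.pi))⁻¹ = (2 * Real.pi)⁻¹ := by
    rw [← mul_inv, Real.mul_self_sqrt (by positivity)]
  rw [← e, mul_add, Real.exp_add]
  ring

lemma integral_gaussian_prod_log_mul_log (b : ℝ) :
    ∫ p : ℝ × ℝ, Real.log p.1 * Real.log (Real.cos b * p.1 + Real.sin b * p.2)
        ∂((gaussianReal 0 1).prod (gaussianReal 0 1))
      = (2 * Real.pi)⁻¹ *
        ((∫ r in Set.Ioi (0 : ℝ), r * Real.exp (-(1 / 2) * r ^ 2) * Real.log (r / 2) ^ 2)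
            * (2 * Real.pi)
          + (∫ r in Set.Ioi (0 : ℝ), r * Real.exp (-(1 / 2) * r ^ 2) * Real.log (r / 2))
            * (2 * ∫ x in Set.Ioo (-Real.pi) Real.pi, Real.log (2 * Real.cos x))
          + ∫ x in Set.Ioo (-Real.pi) Real.pi,
              Real.log (2 * Real.cos x) * Real.log (2 * Real.cos (x - b))) := by
  have hpi := Real.pi_pos
  have hg := memLp_log_two_mul_cos_sub 0
  have hgb := memLp_log_two_mul_cos_sub b
  simp only [sub_zero] at hg
  set w : ℝ → ℝ := fun r => r * Real.exp (-(1 / 2) * r ^ 2) with hw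
  set ν := (volume.restrict (Set.Ioi (0 : ℝ))) with hν
  set κ := (volume.restrict (Set.Ioo (-Real.pi) Real.pi)) with hκ
  have i0 : Integrable w ν := (integrable_mul_exp_neg_mul_sq (by norm_num)).integrableOn
  have i2 : Integrable (fun r => w r * Real.log (r / 2) ^ 2) ν := integrableOn_mul_exp_mul_sq_log
  have i1 : Integrable (fun r => w r * Real.log (r / 2)) ν := by
    refine Integrable.mono' (i0.add i2) (Measurable.aestronglyMeasurable (by fun_prop)) ?_
    filter_upwards [ae_restrict_mem measurableSet_Ioi] with r hr
    have hr0 : (0 : ℝ) < r := hr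
    have hw0 : 0 ≤ w r := by simp only [hw]; positivity
    rw [norm_mul, Real.norm_of_nonneg hw0, Pi.add_apply, Real.norm_eq_abs]
    have : |Real.log (r / 2)| ≤ 1 + Real.log (r / 2) ^ 2 := by
      rw [← sq_abs]; nlinarith [sq_nonneg (|Real.log (r / 2)| - 1)]
    calc _ ≤ w r * (1 + Real.log (r / 2) ^ 2) := by gcongr
      _ = _ := by ring
  have iG : Integrable (fun x => Real.log (2 * Real.cos x) + Real.log (2 * Real.cos (x - b))) κ :=
    (hg.integrable (by norm_num)).add (hgb.integrable (by norm_num))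
  have iGG : Integrable (fun x => Real.log (2 * Real.cos x) * Real.log (2 * Real.cos (x - b))) κ :=
    hg.integrable_mul hgb
  have hvol : volume.restrict (Set.Ioi (0 : ℝ) ×ˢ Set.Ioo (-Real.pi) Real.pi) = ν.prod κ := by
    rw [Measure.volume_eq_prod, Measure.prod_restrict]
  rw [integral_gaussian_prod_eq, ← integral_comp_polarCoord_symm, polarCoord_target, hvol]
  have hcos : ∀ᵐ p ∂(ν.prod κ), Real.cos p.2 ≠ 0 ∧ Real.cos (p.2 - b) ≠ 0 ∧ 0 < p.1 := by
    have hc : ∀ a : ℝ, ∀ᵐ x ∂κ, Real.cos (x - a) ≠ 0 := by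
      intro a
      refine ae_restrict_of_ae ?_
      have : {x : ℝ | ¬ Real.cos (x - a) ≠ 0} ⊆
          Set.range (fun k : ℤ => (2 * k + 1) * Real.pi / 2 + a) := by
        intro x hx
        simp only [ne_eq, not_not, Set.mem_ofPred_eq] at hx
        obtain ⟨k, hk⟩ := Real.cos_eq_zero_iff.1 hx
        exact ⟨k, by simp only; linarith⟩
      exact ((Set.countable_range _).mono this).measure_zero _
    have h1 : ∀ᵐ p ∂(ν.prod κ), Real.cos p.2 ≠ 0 := by
      have := Measure.quasiMeasurePreserving_snd (μ := ν) (ν := κ) |>.ae (hc 0)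
      simpa using this
    have h2 : ∀ᵐ p ∂(ν.prod κ), Real.cos (p.2 - b) ≠ 0 :=
      Measure.quasiMeasurePreserving_snd (μ := ν) (ν := κ) |>.ae (hc b)
    have h3 : ∀ᵐ p ∂(ν.prod κ), 0 < p.1 :=
      Measure.quasiMeasurePreserving_fst (μ := ν) (ν := κ) |>.ae
        (ae_restrict_mem measurableSet_Ioi)
    filter_upwards [h1, h2, h3] with p a1 a2 a3
    exact ⟨a1, a2, a3⟩
  have hint : ∫ p, p.1 • ((2 * Real.pi)⁻¹ * Real.exp (-(1 / 2) * ((polarCoord.symm p).1 ^ 2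
        + (polarCoord.symm p).2 ^ 2)) * (Real.log (polarCoord.symm p).1 *
        Real.log (Real.cos b * (polarCoord.symm p).1 + Real.sin b * (polarCoord.symm p).2)))
        ∂(ν.prod κ)
      = ∫ p, (2 * Real.pi)⁻¹ * ((w p.1 * Real.log (p.1 / 2) ^ 2) * 1
          + (w p.1 * Real.log (p.1 / 2)) *
            (Real.log (2 * Real.cos p.2) + Real.log (2 * Real.cos (p.2 - b)))
          + w p.1 * (Real.log (2 * Real.cos p.2) * Real.log (2 * Real.cos (p.2 - b))))
        ∂(ν.prod κ) := by
    refine integral_congr_ae ?_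
    filter_upwards [hcos] with p hp
    obtain ⟨c1, c2, c3⟩ := hp
    have hr : p.1 / 2 ≠ 0 := by positivity
    simp only [polarCoord_symm_apply, smul_eq_mul]
    have e1 : (p.1 * Real.cos p.2) ^ 2 + (p.1 * Real.sin p.2) ^ 2 = p.1 ^ 2 := by
      linear_combination p.1 ^ 2 * Real.sin_sq_add_cos_sq p.2
    have e2 : Real.cos b * (p.1 * Real.cos p.2) + Real.sin b * (p.1 * Real.sin p.2)
        = p.1 / 2 * (2 * Real.cos (p.2 - b)) := by rw [Real.cos_sub]; ring
    have e3 : p.1 * Real.cos p.2 = p.1 / 2 * (2 * Real.cos p.2) := by ring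
    rw [e1, e2, e3, Real.log_mul hr (by simpa using c1), Real.log_mul hr (by simpa using c2)]
    simp only [hw]
    ring
  have iC : Integrable (fun _ : ℝ => (1 : ℝ)) κ := integrable_const _
  have j2 : Integrable (fun p : ℝ × ℝ => (w p.1 * Real.log (p.1 / 2) ^ 2) * 1) (ν.prod κ) :=
    i2.mul_prod iC
  have j1 : Integrable (fun p : ℝ × ℝ => (w p.1 * Real.log (p.1 / 2)) *
      (Real.log (2 * Real.cos p.2) + Real.log (2 * Real.cos (p.2 - b)))) (ν.prod κ) :=
    i1.mul_prod iG
  have j0 : Integrable (fun p : ℝ × ℝ => w p.1 *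
      (Real.log (2 * Real.cos p.2) * Real.log (2 * Real.cos (p.2 - b)))) (ν.prod κ) :=
    i0.mul_prod iGG
  have j21 : Integrable (fun p : ℝ × ℝ => (w p.1 * Real.log (p.1 / 2) ^ 2) * 1
      + (w p.1 * Real.log (p.1 / 2)) *
      (Real.log (2 * Real.cos p.2) + Real.log (2 * Real.cos (p.2 - b)))) (ν.prod κ) := j2.add j1
  rw [hint, integral_const_mul, integral_add j21 j0, integral_add j2 j1,
    integral_prod_mul (fun r => w r * Real.log (r / 2) ^ 2) (fun _ => (1 : ℝ)),
    integral_prod_mul (fun r => w r * Real.log (r / 2))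
      (fun x => Real.log (2 * Real.cos x) + Real.log (2 * Real.cos (x - b))),
    integral_prod_mul w
      (fun x => Real.log (2 * Real.cos x) * Real.log (2 * Real.cos (x - b))),
    integral_add (hg.integrable (by norm_num)) (hgb.integrable (by norm_num)),
    integral_log_two_mul_cos_sub b]
  have hw1 : ∫ r, w r ∂ν = 1 := integral_Ioi_mul_exp
  have hk1 : ∫ _, (1 : ℝ) ∂κ = 2 * Real.pi := by
    rw [hκ]; simp; rw [max_eq_left (by positivity)]; ring
  rw [hw1, hk1]
  ring

/-- The mixed second moment of `log |X|` and `log |Y|` for a standard Gaussian pair with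
correlation `cos b`. -/
lemma integral_gaussian_prod_log_mul_log_eq {b : ℝ} (h0 : 0 ≤ b) (h1 : b ≤ Real.pi) :
    ∫ p : ℝ × ℝ, Real.log p.1 * Real.log (Real.cos b * p.1 + Real.sin b * p.2)
        ∂((gaussianReal 0 1).prod (gaussianReal 0 1))
      = (∫ x, Real.log x ∂(gaussianReal 0 1)) ^ 2 + (Real.pi / 2 - b) ^ 2 / 2 := by
  have hpi := Real.pi_pos
  have hb := integral_gaussian_prod_log_mul_log b
  have hp := integral_gaussian_prod_log_mul_log (Real.pi / 2)
  rw [integral_log_cos_mul_log_cos_sub h0 h1] at hb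
  rw [integral_log_cos_mul_log_cos_sub (by positivity) (by linarith)] at hp
  simp only [Real.cos_pi_div_two, Real.sin_pi_div_two, zero_mul, one_mul, zero_add] at hp
  rw [integral_prod_mul Real.log Real.log] at hp
  rw [hb, sq (∫ x, Real.log x ∂(gaussianReal 0 1)), hp]
  field_simp
  ring

/-- A process with almost surely continuous paths agrees almost surely, at all times
simultaneously, with a jointly measurable process. -/
lemma exists_measurable_uncurry_of_ae_continuous {Ω : Type*} [MeasurableSpace Ω] {P : Measure Ω}
    {Y : ℝ≥0 → Ω → ℝ} (hm : ∀ t, AEMeasurable (Y t) P)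
    (hc : ∀ᵐ ω ∂P, Continuous (fun t => Y t ω)) :
    ∃ Z : ℝ≥0 → Ω → ℝ, Measurable (Function.uncurry Z) ∧ ∀ᵐ ω ∂P, ∀ t, Z t ω = Y t ω := by
  classical
  have h1 : ∀ᵐ ω ∂P, Continuous (fun t => Y t ω) ∧
      ∀ n k : ℕ, Y (k / n) ω = (hm (k / n)).mk (Y (k / n)) ω := by
    refine hc.and ?_
    rw [ae_all_iff]
    intro n
    rw [ae_all_iff]
    intro k
    exact (hm (k / n)).ae_eq_mk
  obtain ⟨N, hN, hNm, hN0⟩ := exists_measurable_superset_of_null (ae_iff.1 h1)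
  have hS : ∀ ω ∉ N, Continuous (fun t => Y t ω) ∧
      ∀ n k : ℕ, Y (k / n) ω = (hm (k / n)).mk (Y (k / n)) ω := by
    intro ω hω
    by_contra h
    exact hω (hN h)
  set Z : ℝ≥0 → Ω → ℝ := fun t => Nᶜ.indicator (Y t) with hZ
  have hZc : ∀ ω, Continuous (fun t => Z t ω) := by
    intro ω
    by_cases h : ω ∈ N
    · simp only [hZ, Set.indicator, Set.mem_compl_iff, h, not_true, if_false]
      exact continuous_const
    · simp only [hZ, Set.indicator, Set.mem_compl_iff, h, not_false_iff, if_true]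
      exact (hS ω h).1
  have hZm : ∀ t, Measurable (Z t) := by
    intro t
    refine measurable_of_tendsto_metrizable
      (f := fun (n : ℕ) ω => Z ((⌊(t : ℝ) * n⌋₊ : ℕ) / n) ω) (fun n => ?_) ?_
    · have : Z ((⌊(t : ℝ) * n⌋₊ : ℕ) / n) = Nᶜ.indicator
          ((hm ((⌊(t : ℝ) * n⌋₊ : ℕ) / n)).mk (Y ((⌊(t : ℝ) * n⌋₊ : ℕ) / n))) := by
        ext ω
        by_cases h : ω ∈ N
        · simp [hZ, h]
        · simp only [hZ, Set.indicator, Set.mem_compl_iff, h, not_false_iff, if_true]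
          exact (hS ω h).2 n _
      change Measurable (Z ((⌊(t : ℝ) * n⌋₊ : ℕ) / n))
      rw [this]
      exact (AEMeasurable.measurable_mk _).indicator hNm.compl
    · rw [tendsto_pi_nhds]
      intro ω
      have h2 : Tendsto (fun n : ℕ => ((⌊(t : ℝ) * n⌋₊ : ℕ) : ℝ≥0) / n) atTop (𝓝 t) :=
        NNReal.tendsto_coe.1 (by
          push_cast
          exact (tendsto_nat_floor_mul_div_atTop (R := ℝ) t.2).comp tendsto_natCast_atTop_atTop)
      exact ((hZc ω).tendsto t).comp h2
  refine ⟨Z, measurable_uncurry_of_continuous_of_measurable hZc hZm, ?_⟩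
  have : ∀ᵐ ω ∂P, ω ∉ N := measure_eq_zero_iff_ae_notMem.1 hN0
  filter_upwards [this] with ω hω t
  simp [hZ, hω]

lemma integral_mul_self_eq_integral_prod {Ω : Type*} (L : ℝ → Ω → ℝ) (T : ℝ) (ω : Ω) :
    (∫ t in Set.Ioc 0 T, L t ω) ^ 2 = ∫ p : ℝ × ℝ, L p.1 ω * L p.2 ω
      ∂((volume.restrict (Set.Ioc 0 T)).prod (volume.restrict (Set.Ioc 0 T))) := by
  rw [integral_prod_mul (fun t => L t ω) (fun t => L t ω), sq]

section PathIntegral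

variable {Ω : Type*} [MeasurableSpace Ω] {P : Measure Ω} [IsProbabilityMeasure P]
  {L : ℝ → Ω → ℝ} {K : ℝ → ℝ} {m : ℝ}

lemma ae_pos_restrict_Ioc (T : ℝ) : ∀ᵐ t ∂(volume.restrict (Set.Ioc 0 T)), 0 ≤ t := by
  filter_upwards [ae_restrict_mem measurableSet_Ioc] with t ht using ht.1.le

lemma integrable_uncurry_of_second_order (hL : Measurable (Function.uncurry L))
    (hL2 : ∀ t, 0 ≤ t → MemLp (L t) 2 P)
    (hcov : ∀ s t, 0 ≤ s → 0 ≤ t → ∫ ω, L s ω * L t ω ∂P = m ^ 2 + K |s - t|) (T : ℝ) :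
    Integrable (Function.uncurry L) ((volume.restrict (Set.Ioc 0 T)).prod P) := by
  rw [integrable_prod_iff hL.aestronglyMeasurable]
  refine ⟨?_, ?_⟩
  · filter_upwards [ae_pos_restrict_Ioc T] with t ht
    exact (hL2 t ht).integrable (by norm_num)
  · refine Integrable.mono' (integrable_const (1 + (m ^ 2 + K 0)))
      hL.aestronglyMeasurable.norm.integral_prod_right' ?_
    filter_upwards [ae_pos_restrict_Ioc T] with t ht
    have h1 := hcov t t ht ht
    rw [sub_self, abs_zero] at h1
    have hi : Integrable (fun ω => L t ω * L t ω) P := (hL2 t ht).integrable_mul (hL2 t ht)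
    rw [Real.norm_of_nonneg (integral_nonneg fun _ => norm_nonneg _), ← h1]
    have e : 1 + ∫ ω, L t ω * L t ω ∂P = ∫ ω, (1 + L t ω * L t ω) ∂P := by
      rw [integral_add (integrable_const _) hi]; simp
    rw [e]
    refine integral_mono ((hL2 t ht).integrable (by norm_num)).norm
      ((integrable_const _).add hi) fun ω => ?_
    simp only [Function.uncurry_apply_pair, Real.norm_eq_abs]
    rw [← abs_mul_abs_self (L t ω)]
    nlinarith [sq_nonneg (|L t ω| - 1)]

lemma integrable_mul_of_second_order (hL : Measurable (Function.uncurry L))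
    (hL2 : ∀ t, 0 ≤ t → MemLp (L t) 2 P)
    (hcov : ∀ s t, 0 ≤ s → 0 ≤ t → ∫ ω, L s ω * L t ω ∂P = m ^ 2 + K |s - t|) (T : ℝ) :
    Integrable (fun q : (ℝ × ℝ) × Ω => L q.1.1 q.2 * L q.1.2 q.2)
      (((volume.restrict (Set.Ioc 0 T)).prod (volume.restrict (Set.Ioc 0 T))).prod P) := by
  have hm : Measurable (fun q : (ℝ × ℝ) × Ω => L q.1.1 q.2 * L q.1.2 q.2) := by
    have h1 : Measurable (fun q : (ℝ × ℝ) × Ω => Function.uncurry L (q.1.1, q.2)) :=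
      hL.comp (by fun_prop)
    have h2 : Measurable (fun q : (ℝ × ℝ) × Ω => Function.uncurry L (q.1.2, q.2)) :=
      hL.comp (by fun_prop)
    exact h1.mul h2
  have hae : ∀ᵐ p ∂((volume.restrict (Set.Ioc 0 T)).prod (volume.restrict (Set.Ioc 0 T))),
      0 ≤ p.1 ∧ 0 ≤ p.2 :=
    (Measure.quasiMeasurePreserving_fst.ae (ae_pos_restrict_Ioc T)).and
      (Measure.quasiMeasurePreserving_snd.ae (ae_pos_restrict_Ioc T))
  rw [integrable_prod_iff hm.aestronglyMeasurable]
  refine ⟨?_, ?_⟩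
  · filter_upwards [hae] with p hp
    exact (hL2 _ hp.1).integrable_mul (hL2 _ hp.2)
  · refine Integrable.mono' (integrable_const (m ^ 2 + K 0))
      hm.aestronglyMeasurable.norm.integral_prod_right' ?_
    filter_upwards [hae] with p hp
    have h1 := hcov _ _ hp.1 hp.1
    have h2 := hcov _ _ hp.2 hp.2
    rw [sub_self, abs_zero] at h1 h2
    have i1 : Integrable (fun ω => L p.1 ω * L p.1 ω) P := (hL2 _ hp.1).integrable_mul (hL2 _ hp.1)
    have i2 : Integrable (fun ω => L p.2 ω * L p.2 ω) P := (hL2 _ hp.2).integrable_mul (hL2 _ hp.2)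
    have i12 : Integrable (fun ω => L p.1 ω * L p.2 ω) P := (hL2 _ hp.1).integrable_mul (hL2 _ hp.2)
    have e : m ^ 2 + K 0 = ∫ ω, (L p.1 ω * L p.1 ω + L p.2 ω * L p.2 ω) / 2 ∂P := by
      rw [integral_div, integral_add i1 i2, h1, h2]; ring
    rw [Real.norm_of_nonneg (integral_nonneg fun _ => norm_nonneg _), e]
    refine integral_mono i12.norm ((i1.add i2).div_const 2) fun ω => ?_
    simp only [Real.norm_eq_abs, abs_mul]
    rw [← abs_mul_abs_self (L p.1 ω), ← abs_mul_abs_self (L p.2 ω)]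
    nlinarith [sq_nonneg (|L p.1 ω| - |L p.2 ω|)]

lemma memLp_integral_of_second_order (hL : Measurable (Function.uncurry L))
    (hL2 : ∀ t, 0 ≤ t → MemLp (L t) 2 P)
    (hcov : ∀ s t, 0 ≤ s → 0 ≤ t → ∫ ω, L s ω * L t ω ∂P = m ^ 2 + K |s - t|) (T : ℝ) :
    MemLp (fun ω => ∫ t in Set.Ioc 0 T, L t ω) 2 P := by
  have hm : AEStronglyMeasurable (fun ω => ∫ t in Set.Ioc 0 T, L t ω) P :=
    (hL.comp measurable_swap).stronglyMeasurable.integral_prod_right'.aestronglyMeasurable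
  rw [memLp_two_iff_integrable_sq hm]
  simp_rw [integral_mul_self_eq_integral_prod]
  exact (integrable_mul_of_second_order hL hL2 hcov T).integral_prod_right

lemma variance_integral_of_second_order (hL : Measurable (Function.uncurry L))
    (hL2 : ∀ t, 0 ≤ t → MemLp (L t) 2 P) (hmean : ∀ t, 0 ≤ t → ∫ ω, L t ω ∂P = m)
    (hcov : ∀ s t, 0 ≤ s → 0 ≤ t → ∫ ω, L s ω * L t ω ∂P = m ^ 2 + K |s - t|)
    (hK : Continuous K) {T : ℝ} (hT : 0 ≤ T) :
    variance (fun ω => ∫ t in Set.Ioc 0 T, L t ω) P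
      = ∫ t in (0 : ℝ)..T, ∫ s in (0 : ℝ)..T, K |t - s| := by
  have hae : ∀ᵐ p ∂((volume.restrict (Set.Ioc 0 T)).prod (volume.restrict (Set.Ioc 0 T))),
      0 ≤ p.1 ∧ 0 ≤ p.2 :=
    (Measure.quasiMeasurePreserving_fst.ae (ae_pos_restrict_Ioc T)).and
      (Measure.quasiMeasurePreserving_snd.ae (ae_pos_restrict_Ioc T))
  have hKi : Integrable (fun p : ℝ × ℝ => K |p.1 - p.2|)
      ((volume.restrict (Set.Ioc 0 T)).prod (volume.restrict (Set.Ioc 0 T))) := by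
    rw [Measure.prod_restrict, ← Measure.volume_eq_prod]
    have : IntegrableOn (fun p : ℝ × ℝ => K |p.1 - p.2|) (Set.Icc 0 T ×ˢ Set.Icc 0 T) :=
      ContinuousOn.integrableOn_compact (isCompact_Icc.prod isCompact_Icc) (by fun_prop)
    exact this.mono_set (Set.prod_mono Set.Ioc_subset_Icc_self Set.Ioc_subset_Icc_self)
  have hsq : ∫ ω, (∫ t in Set.Ioc 0 T, L t ω) ^ 2 ∂P
      = T ^ 2 * m ^ 2 + ∫ t in (0 : ℝ)..T, ∫ s in (0 : ℝ)..T, K |t - s| := by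
    simp_rw [integral_mul_self_eq_integral_prod]
    rw [← integral_integral_swap (f := fun (p : ℝ × ℝ) ω => L p.1 ω * L p.2 ω)
      (integrable_mul_of_second_order hL hL2 hcov T)]
    have : ∫ p : ℝ × ℝ, ∫ ω, L p.1 ω * L p.2 ω ∂P
        ∂((volume.restrict (Set.Ioc 0 T)).prod (volume.restrict (Set.Ioc 0 T)))
        = ∫ p : ℝ × ℝ, (m ^ 2 + K |p.1 - p.2|)
        ∂((volume.restrict (Set.Ioc 0 T)).prod (volume.restrict (Set.Ioc 0 T))) := by
      refine integral_congr_ae ?_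
      filter_upwards [hae] with p hp
      exact hcov _ _ hp.1 hp.2
    rw [this, integral_add (integrable_const _) hKi, integral_prod _ hKi]
    simp only [intervalIntegral.integral_of_le hT]
    congr 1
    rw [integral_const, ← Set.univ_prod_univ, measureReal_prod_prod]
    simp [hT]
    exact Or.inl (by ring)
  have hmm : ∫ ω, (∫ t in Set.Ioc 0 T, L t ω) ∂P = T * m := by
    rw [← integral_integral_swap (f := fun t ω => L t ω)
      (integrable_uncurry_of_second_order hL hL2 hcov T)]
    have : ∫ t in Set.Ioc 0 T, ∫ ω, L t ω ∂P = ∫ t in Set.Ioc 0 T, m := by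
      refine integral_congr_ae ?_
      filter_upwards [ae_pos_restrict_Ioc T] with t ht using hmean t ht
    rw [this]
    simp [hT]
  rw [variance_eq_sub (memLp_integral_of_second_order hL hL2 hcov T), hmm]
  simp only [Pi.pow_apply]
  rw [hsq]
  ring

end PathIntegral

/-- Averages of an integrable even kernel over large squares. -/
lemma tendsto_average_kernel {K : ℝ → ℝ} (hK : Continuous K)
    (hKi : IntegrableOn K (Set.Ioi 0)) :
    Tendsto (fun T : ℝ => T⁻¹ * ∫ t in (0 : ℝ)..T, ∫ s in (0 : ℝ)..T, K |t - s|) atTop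
      (𝓝 (2 * ∫ u in Set.Ioi (0 : ℝ), K u)) := by
  set k : ℝ → ℝ := fun u => K |u| with hk
  have hkc : Continuous k := by fun_prop
  have hki : Integrable k := by
    refine integrable_of_even_of_integrableOn_Ioi (by intro x; simp [hk]) ?_
    refine hKi.congr_fun (fun x hx => ?_) measurableSet_Ioi
    simp only [hk]
    rw [abs_of_pos hx]
  have hval : ∫ u, k u = 2 * ∫ u in Set.Ioi (0 : ℝ), K u := integral_comp_abs
  rw [← hval]
  have hlim : Tendsto (fun T : ℝ => ∫ u in (0 : ℝ)..1, ∫ v in (T * u - T)..(T * u), k v) atTop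
      (𝓝 (∫ u in (0 : ℝ)..1, ∫ v, k v)) := by
    simp only [intervalIntegral.integral_of_le zero_le_one]
    refine tendsto_integral_filter_of_dominated_convergence (fun _ => ∫ v, ‖k v‖)
      (Eventually.of_forall fun T => ?_) (Eventually.of_forall fun T => ?_)
      (integrable_const _) ?_
    · have hc : Continuous (fun u => ∫ v in (T * u - T)..(T * u), k v) := by
        have h0 : Continuous (fun x => ∫ v in (0 : ℝ)..x, k v) :=
          intervalIntegral.continuous_primitive (fun a b => hkc.intervalIntegrable a b) 0
        have : (fun u => ∫ v in (T * u - T)..(T * u), k v)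
            = fun u => (∫ v in (0 : ℝ)..(T * u), k v) - ∫ v in (0 : ℝ)..(T * u - T), k v := by
          ext u
          rw [intervalIntegral.integral_interval_sub_left (hkc.intervalIntegrable _ _)
            (hkc.intervalIntegrable _ _)]
        rw [this]
        exact (h0.comp (by fun_prop)).sub (h0.comp (by fun_prop))
      exact hc.aestronglyMeasurable
    · refine ae_of_all _ fun u => ?_
      refine intervalIntegral.norm_integral_le_integral_norm_uIoc.trans ?_
      exact setIntegral_le_integral hki.norm (ae_of_all _ fun _ => norm_nonneg _)
    · rw [Measure.restrict_congr_set Ioo_ae_eq_Ioc.symm]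
      filter_upwards [ae_restrict_mem measurableSet_Ioo] with u hu
      refine intervalIntegral_tendsto_integral hki ?_ ?_
      · have : Tendsto (fun T : ℝ => T * (u - 1)) atTop atBot :=
          tendsto_id.atTop_mul_const_of_neg (by linarith [hu.2])
        exact this.congr fun T => by ring
      · exact tendsto_id.atTop_mul_const hu.1
  simp only [intervalIntegral.integral_const, sub_zero, one_smul] at hlim
  refine hlim.congr' ?_
  filter_upwards [eventually_gt_atTop 0] with T hT
  have h1 := intervalIntegral.integral_comp_mul_left
    (fun t => ∫ v in (t - T)..t, k v) hT.ne' (a := 0) (b := 1)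
  rw [mul_zero, mul_one, smul_eq_mul] at h1
  rw [h1]
  congr 1
  refine intervalIntegral.integral_congr fun t _ => ?_
  rw [intervalIntegral.integral_comp_sub_left (fun v => k v) t, sub_zero]

/-- The covariance of `log |Y_s|` and `log |Y_{s+t}|` for the stationary Ornstein–Uhlenbeck
process with parameter `θ`. -/
noncomputable def logCovKernel (θ t : ℝ) : ℝ := Real.arcsin (Real.exp (-(θ * t))) ^ 2 / 2

lemma continuous_logCovKernel (θ : ℝ) : Continuous (logCovKernel θ) := by
  unfold logCovKernel
  exact ((Real.continuous_arcsin.comp (by fun_prop)).pow 2).div_const 2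

lemma logCovKernel_arcsin_mem {θ t : ℝ} (hθ : 0 < θ) (ht : 0 < t) :
    0 ≤ Real.arcsin (Real.exp (-(θ * t))) ∧ Real.arcsin (Real.exp (-(θ * t))) < Real.pi / 2 ∧
      Real.sin (Real.arcsin (Real.exp (-(θ * t)))) = Real.exp (-(θ * t)) := by
  have h0 := Real.exp_pos (-(θ * t))
  have h1 : Real.exp (-(θ * t)) < 1 := by rw [Real.exp_lt_one_iff]; nlinarith
  exact ⟨Real.arcsin_nonneg.2 h0.le, Real.arcsin_lt_pi_div_two.2 h1,
    Real.sin_arcsin (by linarith) h1.le⟩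

lemma hasSum_logCovKernel {θ t : ℝ} (hθ : 0 < θ) (ht : 0 < t) :
    HasSum (fun j : ℕ => arcsinSqCoeff j / 2 * Real.exp (-(θ * (2 * j + 2)) * t))
      (logCovKernel θ t) := by
  obtain ⟨h0, h1, h2⟩ := logCovKernel_arcsin_mem hθ ht
  refine ((hasSum_arcsinSqCoeff_mul_sin h0 h1).div_const 2).congr_fun fun j => ?_
  rw [h2, ← Real.exp_nat_mul]
  push_cast
  rw [show (2 * (j : ℝ) + 2) * -(θ * t) = -(θ * (2 * j + 2)) * t by ring]
  ring

lemma integrableOn_logCovKernel {θ : ℝ} (hθ : 0 < θ) :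
    IntegrableOn (logCovKernel θ) (Set.Ioi 0) := by
  have hpi := Real.pi_pos
  refine Integrable.mono' ((integrableOn_exp_mul_Ioi (a := -(2 * θ)) (by linarith) 0).const_mul
    (Real.pi ^ 2 / 8)) (continuous_logCovKernel θ).aestronglyMeasurable ?_
  filter_upwards [ae_restrict_mem measurableSet_Ioi] with t ht
  obtain ⟨h0, h1, h2⟩ := logCovKernel_arcsin_mem hθ ht
  have h3 := Real.mul_le_sin h0 h1.le
  rw [h2] at h3
  set x := Real.arcsin (Real.exp (-(θ * t))) with hx
  have h4 : x ≤ Real.pi / 2 * Real.exp (-(θ * t)) := by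
    calc x = Real.pi / 2 * (2 / Real.pi * x) := by field_simp
      _ ≤ _ := by gcongr
  have h5 : Real.exp (-(2 * θ) * t) = Real.exp (-(θ * t)) ^ 2 := by
    rw [← Real.exp_nat_mul]; push_cast; ring_nf
  rw [logCovKernel, ← hx, Real.norm_of_nonneg (by positivity), h5]
  calc x ^ 2 / 2 ≤ (Real.pi / 2 * Real.exp (-(θ * t))) ^ 2 / 2 := by gcongr
    _ = _ := by ring

lemma two_mul_integral_logCovKernel {θ : ℝ} (hθ : 0 < θ) :
    2 * ∫ t in Set.Ioi (0 : ℝ), logCovKernel θ t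
      = 1 / θ * (Real.pi ^ 2 * Real.log 2 / 4 - 7 * (riemannZeta 3).re / 8) := by
  have hI : ∀ j : ℕ, ∫ t in Set.Ioi (0 : ℝ), arcsinSqCoeff j / 2 *
      Real.exp (-(θ * (2 * j + 2)) * t) = 1 / (2 * θ) * (arcsinSqCoeff j / (2 * (j + 1))) := by
    intro j
    have : -(θ * (2 * (j : ℝ) + 2)) < 0 := by
      have : 0 < θ * (2 * (j : ℝ) + 2) := by positivity
      linarith
    rw [integral_const_mul, integral_exp_mul_Ioi this]
    simp
    field_simp
  have hint : ∀ j : ℕ, IntegrableOn (fun t => arcsinSqCoeff j / 2 *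
      Real.exp (-(θ * (2 * j + 2)) * t)) (Set.Ioi 0) := by
    intro j
    have : -(θ * (2 * (j : ℝ) + 2)) < 0 := by
      have : 0 < θ * (2 * (j : ℝ) + 2) := by positivity
      linarith
    exact (integrableOn_exp_mul_Ioi this 0).const_mul _
  have hnorm : ∀ j : ℕ, ∫ t in Set.Ioi (0 : ℝ), ‖arcsinSqCoeff j / 2 *
      Real.exp (-(θ * (2 * j + 2)) * t)‖ = 1 / (2 * θ) * (arcsinSqCoeff j / (2 * (j + 1))) := by
    intro j
    rw [← hI]
    congr 1 with t
    have := arcsinSqCoeff_pos j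
    exact Real.norm_of_nonneg (by positivity)
  have h := hasSum_integral_of_summable_integral_norm hint
    (by simp_rw [hnorm]; exact summable_arcsinSqCoeff_div.mul_left _)
  simp_rw [hI] at h
  have h2 := h.unique (hasSum_arcsinSqCoeff_div.mul_left (1 / (2 * θ)))
  have h3 : ∫ t in Set.Ioi (0 : ℝ), logCovKernel θ t = ∫ t in Set.Ioi (0 : ℝ),
      ∑' j : ℕ, arcsinSqCoeff j / 2 * Real.exp (-(θ * (2 * j + 2)) * t) :=
    setIntegral_congr_fun measurableSet_Ioi fun t ht => (hasSum_logCovKernel hθ ht).tsum_eq.symm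
  rw [h3, h2]
  field_simp

namespace IsOrnsteinUhlenbeck

variable {Ω : Type*} [MeasurableSpace Ω] {P : Measure Ω} [IsProbabilityMeasure P]
  {θ : ℝ} {W Y : ℝ≥0 → Ω → ℝ}

lemma hasLaw (hY : IsOrnsteinUhlenbeck θ W Y P) (hstat : IsStationaryProcess Y P)
    (hθ : 0 < θ) (t : ℝ≥0) : HasLaw (Y t) (gaussianReal 0 1) P := by
  refine ⟨hY.aemeasurable t, ?_⟩
  have := (hstat.identDistrib_shift t {0}).comp
    (u := fun x : ({0} : Finset ℝ≥0) → ℝ => x ⟨0, by simp⟩) (measurable_pi_apply _)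
  rw [← (hY.hasLaw_zero hstat hθ).map_eq]
  simpa [Function.comp_def] using this.map_eq

lemma integral_log_mul_log (hY : IsOrnsteinUhlenbeck θ W Y P) (hstat : IsStationaryProcess Y P)
    (hθ : 0 < θ) (s h : ℝ≥0) :
    ∫ ω, Real.log (Y s ω) * Real.log (Y (h + s) ω) ∂P
      = (∫ x, Real.log x ∂(gaussianReal 0 1)) ^ 2 + logCovKernel θ h := by
  have hid := (hstat.identDistrib_shift s {0, h}).comp
    (u := fun x : (({0, h} : Finset ℝ≥0)) → ℝ => Real.log (x ⟨0, by simp⟩) *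
      Real.log (x ⟨h, by simp⟩)) (by fun_prop)
  have h1 := hid.integral_eq
  simp only [Function.comp_def, zero_add] at h1
  rw [h1]
  have hm : AEMeasurable (fun ω => (Y 0 ω, Y h ω)) P :=
    (hY.aemeasurable 0).prodMk (hY.aemeasurable h)
  have hf : Measurable (fun p : ℝ × ℝ => Real.log p.1 * Real.log p.2) := by fun_prop
  have h2 := integral_map hm hf.aestronglyMeasurable
  simp only at h2
  rw [← h2, hY.map_prodMk hstat hθ h, integral_map (Measurable.aemeasurable (by fun_prop))
    hf.aestronglyMeasurable]
  have hρ1 : Real.exp (-(θ * h)) ≤ 1 := by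
    rw [Real.exp_le_one_iff]
    have := h.2
    simp
    positivity
  have h3 := integral_gaussian_prod_log_mul_log_eq
    (Real.arccos_nonneg (Real.exp (-(θ * h)))) (Real.arccos_le_pi _)
  rw [Real.cos_arccos (by linarith [Real.exp_pos (-(θ * h))]) hρ1, Real.sin_arccos] at h3
  rw [h3, logCovKernel, Real.arccos]
  ring

end IsOrnsteinUhlenbeck

lemma hasSum_eta_factorial (θ : ℝ) :
    HasSum (fun j : ℕ => (1 / θ) *
        ((2 : ℝ) ^ (2 * (j + 1) - 2) * (((j + 1 - 1).factorial : ℝ)) ^ 2 /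
          (((2 * (j + 1)).factorial : ℝ) * ((j + 1 : ℕ) : ℝ))))
      (1 / θ * (Real.pi ^ 2 * Real.log 2 / 4 - 7 * (riemannZeta 3).re / 8)) := by
  refine (hasSum_arcsinSqCoeff_div.mul_left (1 / θ)).congr_fun fun j => ?_
  rw [arcsinSqCoeff, show 2 * (j + 1) - 2 = 2 * j by omega, show j + 1 - 1 = j by omega,
    show 2 * (j + 1) = 2 * j + 2 by ring]
  push_cast
  field_simp
  ring

lemma hasSum_eta_choose (θ : ℝ) :
    HasSum (fun n : ℕ => (1 / θ) *
        ((2 : ℝ) ^ (2 * (n : ℤ) - 1) /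
          (((2 * n).choose n : ℝ) * ((n : ℝ) + 1) ^ 2 * (2 * (n : ℝ) + 1))))
      (1 / θ * (Real.pi ^ 2 * Real.log 2 / 4 - 7 * (riemannZeta 3).re / 8)) := by
  refine (hasSum_arcsinSqCoeff_div.mul_left (1 / θ)).congr_fun fun n => ?_
  have hc : ((2 * n).choose n : ℝ) = (2 * n).factorial / (n.factorial * n.factorial) := by
    rw [Nat.cast_choose ℝ (by omega : n ≤ 2 * n), show 2 * n - n = n by omega]
  have hp : (2 : ℝ) ^ (2 * (n : ℤ) - 1) = 2 ^ (2 * n) / 2 := by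
    rw [zpow_sub₀ two_ne_zero, zpow_one]
    norm_cast
  rw [arcsinSqCoeff, hc, hp, Nat.factorial_succ (2 * n + 1), Nat.factorial_succ (2 * n)]
  push_cast
  field_simp
  ring

theorem mainTheorem2 {Ω : Type*} [MeasurableSpace Ω] (P : Measure Ω) [IsProbabilityMeasure P]
    (θ : ℝ) (hθ : 0 < θ) (W Y : ℝ≥0 → Ω → ℝ)
    (hY : IsOrnsteinUhlenbeck θ W Y P) (hstat : IsStationaryProcess Y P) :
    -- the path integrals exist almost surely and are square integrable
    (∀ T : ℝ, 0 < T →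
      (∀ᵐ ω ∂P, IntervalIntegrable (fun t : ℝ => Real.log |Y t.toNNReal ω|) volume 0 T) ∧
      MemLp (logIntegral Y T) 2 P) ∧
    ∃ η : ℝ, 0 < η ∧
      -- `η ^ 2` is the limiting variance of `T ^ (-1/2) * ∫₀ᵀ ln|Y_t| dt`
      Tendsto (fun T : ℝ => variance (fun ω => (√T)⁻¹ * logIntegral Y T ω) P)
        atTop (𝓝 (η ^ 2)) ∧
      -- the sum over `k ≥ 1`, with `k = j + 1`
      HasSum (fun j : ℕ => (1 / θ) *
        ((2 : ℝ) ^ (2 * (j + 1) - 2) * (((j + 1 - 1).factorial : ℝ)) ^ 2 /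
          (((2 * (j + 1)).factorial : ℝ) * ((j + 1 : ℕ) : ℝ)))) (η ^ 2) ∧
      -- the same sum in terms of central binomial coefficients
      HasSum (fun n : ℕ => (1 / θ) *
        ((2 : ℝ) ^ (2 * (n : ℤ) - 1) /
          (((2 * n).choose n : ℝ) * ((n : ℝ) + 1) ^ 2 * (2 * (n : ℝ) + 1)))) (η ^ 2) ∧
      -- the closed form
      η ^ 2 = (1 / θ) *
        (Real.pi ^ 2 * Real.log 2 / 4 - 7 * (riemannZeta 3).re / 8) := by
  obtain ⟨Z, hZm, hZY⟩ := exists_measurable_uncurry_of_ae_continuous hY.aemeasurable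
    hY.continuous_paths
  have hZt : ∀ t, Z t =ᵐ[P] Y t := fun t => by filter_upwards [hZY] with ω hω using hω t
  set L : ℝ → Ω → ℝ := fun t ω => Real.log (Z t.toNNReal ω) with hLdef
  set m : ℝ := ∫ x, Real.log x ∂(gaussianReal 0 1) with hmdef
  have hL : Measurable (Function.uncurry L) := by
    have : Measurable (fun p : ℝ × Ω => Function.uncurry Z (p.1.toNNReal, p.2)) :=
      hZm.comp (by fun_prop)
    exact Real.measurable_log.comp this
  have hlaw : ∀ t, HasLaw (Z t) (gaussianReal 0 1) P := fun t =>
    (hY.hasLaw hstat hθ t).congr (hZt t)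
  have hL2 : ∀ t, 0 ≤ t → MemLp (L t) 2 P := by
    intro t _
    have h := memLp_log_gaussianReal
    rw [← (hlaw t.toNNReal).map_eq] at h
    exact h.comp_of_map (hlaw t.toNNReal).aemeasurable
  have hmean : ∀ t, 0 ≤ t → ∫ ω, L t ω ∂P = m := by
    intro t _
    rw [hmdef, ← (hlaw t.toNNReal).map_eq, integral_map (hlaw _).aemeasurable
      Real.measurable_log.aestronglyMeasurable]
  have hcov1 : ∀ s t, 0 ≤ s → s ≤ t →
      ∫ ω, L s ω * L t ω ∂P = m ^ 2 + logCovKernel θ |s - t| := by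
    intro s t hs hst
    have h := hY.integral_log_mul_log hstat hθ s.toNNReal (t - s).toNNReal
    rw [← Real.toNNReal_add (by linarith) hs, sub_add_cancel, Real.coe_toNNReal _ (by linarith)]
      at h
    rw [abs_sub_comm, abs_of_nonneg (by linarith : 0 ≤ t - s), ← h]
    refine integral_congr_ae ?_
    filter_upwards [hZY] with ω hω
    simp only [hLdef, hω]
  have hcov : ∀ s t, 0 ≤ s → 0 ≤ t →
      ∫ ω, L s ω * L t ω ∂P = m ^ 2 + logCovKernel θ |s - t| := by
    intro s t hs ht
    rcases le_total s t with h | h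
    · exact hcov1 s t hs h
    · rw [abs_sub_comm, ← hcov1 t s ht h]
      simp_rw [mul_comm]
  have hlog : ∀ T : ℝ, 0 ≤ T →
      (fun ω => ∫ t in Set.Ioc 0 T, L t ω) =ᵐ[P] logIntegral Y T := by
    intro T hT
    filter_upwards [hZY] with ω hω
    rw [logIntegral, intervalIntegral.integral_of_le hT]
    simp only [hLdef, hω, Real.log_abs]
  refine ⟨fun T hT => ⟨?_, ?_⟩, ?_⟩
  · have h := (integrable_uncurry_of_second_order hL hL2 hcov T).prod_left_ae
    filter_upwards [h, hZY] with ω h1 hω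
    rw [intervalIntegrable_iff_integrableOn_Ioc_of_le hT.le, IntegrableOn]
    simpa only [Function.uncurry_apply_pair, hLdef, hω, Real.log_abs] using h1
  · exact (memLp_integral_of_second_order hL hL2 hcov T).ae_eq (hlog T hT.le)
  · set v : ℝ := 1 / θ * (Real.pi ^ 2 * Real.log 2 / 4 - 7 * (riemannZeta 3).re / 8) with hv
    have hvpos : 0 < v := by
      refine mul_pos (by positivity) ?_
      rw [← hasSum_arcsinSqCoeff_div.tsum_eq]
      exact summable_arcsinSqCoeff_div.tsum_pos
        (fun j => by have := arcsinSqCoeff_pos j; positivity) 0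
        (by have := arcsinSqCoeff_pos 0; positivity)
    have hη : √v ^ 2 = v := Real.sq_sqrt hvpos.le
    refine ⟨√v, Real.sqrt_pos.2 hvpos, ?_, ?_, ?_, hη⟩
    · rw [hη, hv, ← two_mul_integral_logCovKernel hθ]
      refine (tendsto_average_kernel (continuous_logCovKernel θ)
        (integrableOn_logCovKernel hθ)).congr' ?_
      filter_upwards [eventually_gt_atTop 0] with T hT
      rw [variance_const_mul, inv_pow, Real.sq_sqrt hT.le,
        ← variance_integral_of_second_order hL hL2 hmean hcov (continuous_logCovKernel θ) hT.le,
        variance_congr (hlog T hT.le)]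
    · rw [hη]; exact hasSum_eta_factorial θ
    · rw [hη]; exact hasSum_eta_choose θ
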